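/- Let $d\ge 1$; all $L^2$ and $L^\infty$ norms are taken on $[0,1]^d$ with Lebesgue measure, and functions on $[0,1]^d$ are treated as $0$ outside $[0,1]^d$ when they are evaluated there. **Networks.** Let $\rho(x)=\max\{x,0\}$, applied elementwise. For positive integers $L,S,D$ with $D\ge d$ and a real $B\ge1$, let $\mathcal N(L,S,D,B)$ be the set of functions $f=W_{L+1}\circ\rho(W_L\cdot-v_L)\circ\cdots\circ\rho(W_1\cdot-v_1):\mathbb R^d\to\mathbb R$ with $W_1\in\mathbb R^{D\times d}$, $W_2,\dots,W_L\in\mathbb R^{D\times D}$, $W_{L+1}\in\mathbb R^{1\times D}$, $v_1,\dots,v_L\in\mathbb R^D$, all entries bounded by $B$ in absolute value, and at most $S$ nonzero entries in total. For $F>0$ let $\mathcal N_F(L,S,D,B)=\{\operatorname{sgn}(f)\min\{|f|,F\} : f\in\mathcal N(L,S,D,B)\}$. **Approximability.** For $C_1,C_2>0$, $\mathrm{AP}(C_1,C_2)$ is the set of $\phi\in L^2([0,1]^d)$ such that for each $0<\varepsilon<1/2$ there are such $L,S,D,B$ with $L,S,D\le C_1\log(1/\varepsilon)$, $B\le C_2/\varepsilon$,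 and some $g\in\mathcal N(L,S,D,B)$ with $\|g-\phi\|_{L^2}\le\varepsilon$. **Target class.** For $\Phi\subset L^2([0,1]^d)$, an integer $n_s\ge1$ and $C>0$, let $\mathcal I^0_\Phi(n_s,C)$ be the set of functions $\sum_{i=1}^{n_s}c_i\,\phi_i(A_i\cdot-b_i)$ with $\phi_i\in\Phi$, $A_i\in\mathbb R^{d\times d}$ invertible, $b_i\in\mathbb R^d$, $c_i\in\mathbb R$, where $|\det A_i|^{-1}$, $|c_i|$ and the absolute values of all entries of $A_i$ and $b_i$ are at most $C$. **Regression.** One observes i.i.d. pairs $(X_i,Y_i)$, $i=1,\dots,n$, with $Y_i=f^\circ(X_i)+\xi_i$, $X_i$ uniform on $[0,1]^d$, and $\xi_i\sim N(0,\sigma^2)$ independent of $X_i$. An empirical risk minimizer over a class $\mathcal F$ is a measurable map $(X_i,Y_i)_{i=1}^n\mapsto\hat f\in\mathcal F$ for which $\hat f$ minimizes $\frac1n\sum_{i=1}^n(f(X_i)-Y_i)^2$ over $f\in\mathcal F$. The risk is $R(\hat f,f^\circ)=\mathrm E\|\hat f-f^\circ\|_{L^2}^2$. **Theorem.** Let $\Phi\subset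 L^2([0,1]^d)$ satisfy $\|\phi\|_{L^2}=1$ for each $\phi\in\Phi$, $\sup_{\phi\in\Phi}\|\phi\|_{L^\infty}<\infty$, and $\Phi\subset\mathrm{AP}(C_1,C_2)$ for some $C_1,C_2>0$. Then there are constants $K_1,K_2$ and network parameters $L_{1/n},S_{1/n},D_{1/n}\le K_1\log n$ (positive integers, $D_{1/n}\ge d$) and $1\le B_{1/n}\le K_2 n$, for $n\ge2$, such that every $\phi\in\Phi$ is approximated within $1/n$ in $L^2$ by some element of $\mathcal N(L_{1/n},S_{1/n},D_{1/n},B_{1/n})$, and the following holds. For all integers $n_s\ge1$ and all $C>0$ there is $F>0$ such that for every $\sigma>0$ there is $C_3>0$, neither $F$ nor $C_3$ depending on $n$, such that for every $n\ge2$ every empirical risk minimizer $\hat f$ over $$\mathcal N_F\bigl(L_{1/n}+2,\ n_s(S_{1/n}+2D_{1/n}d+d^2+d+1),\ n_sD_{1/n},\ \max\{B_{1/n},C\}\bigr)$$ satisfies $$\sup_{f^\circ\in\mathcal I^0_\Phi(n_s,C)}R(\hat f,f^\circ)\le C_3\frac{(\log n)^3}{n}.$$ -/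

import Mathlib

open MeasureTheory ProbabilityTheory
open scoped ENNReal Matrix

noncomputable section

namespace SparseReLU

/-- The unit cube `[0,1]^d`. -/
def cube (d : ℕ) : Set (Fin d → ℝ) := Set.Icc 0 1

/-- The uniform distribution (Lebesgue measure) on `[0,1]^d`; all `L²` and `L^∞` norms below
are taken with respect to it. -/
def cubeMeasure (d : ℕ) : Measure (Fin d → ℝ) := volume.restrict (cube d)

/-- The ReLU activation function. -/
def relu (x : ℝ) : ℝ := max x 0

/-- Output of the `k+1`-st hidden layer: `ρ(W₁ x - v₁)` for `k = 0`, and then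
`ρ(W_{k+2} h - v_{k+2})` with `h` the output of the previous layer. The families are indexed from
`0`, so that `v k` is the shift of the `k+1`-st layer, and `W k` is the weight matrix between the
hidden layers `k+1` and `k+2`. -/
def hiddenLayer {d D : ℕ} (W₁ : Matrix (Fin D) (Fin d) ℝ) (W : ℕ → Matrix (Fin D) (Fin D) ℝ)
    (v : ℕ → Fin D → ℝ) (x : Fin d → ℝ) : ℕ → Fin D → ℝ
  | 0 => fun i => relu ((W₁ *ᵥ x) i - v 0 i)
  | k + 1 => fun i => relu ((W k *ᵥ hiddenLayer W₁ W v x k) i - v (k + 1) i)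

/-- The number of nonzero entries of a vector. -/
def vecNnz {m : ℕ} (v : Fin m → ℝ) : ℕ := {i | v i ≠ 0}.ncard

/-- The number of nonzero entries of a matrix. -/
def matNnz {m k : ℕ} (A : Matrix (Fin m) (Fin k) ℝ) : ℕ :=
  {p : Fin m × Fin k | A p.1 p.2 ≠ 0}.ncard

/-- The class `𝒩(L, S, D, B)` of functions `ℝ^d → ℝ` realized by ReLU networks with `L ≥ 1` hidden
layers of width `D`, at most `S` nonzero parameters, and all parameters bounded by `B`. The output
matrix `W_{L+1} ∈ ℝ^{1×D}` is the row vector `w`. -/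
def network (d L S D : ℕ) (B : ℝ) : Set ((Fin d → ℝ) → ℝ) :=
  {f | ∃ (W₁ : Matrix (Fin D) (Fin d) ℝ) (W : ℕ → Matrix (Fin D) (Fin D) ℝ)
      (v : ℕ → Fin D → ℝ) (w : Fin D → ℝ),
    (∀ i j, |W₁ i j| ≤ B) ∧
    (∀ k < L - 1, ∀ i j, |W k i j| ≤ B) ∧
    (∀ k < L, ∀ i, |v k i| ≤ B) ∧
    (∀ i, |w i| ≤ B) ∧
    matNnz W₁ + ∑ k ∈ Finset.range (L - 1), matNnz (W k) + vecNnz w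
      + ∑ k ∈ Finset.range L, vecNnz (v k) ≤ S ∧
    f = fun x => ∑ i, w i * hiddenLayer W₁ W v x (L - 1) i}

/-- The clipped class `𝒩_F(L, S, D, B) = {sgn(f) min(|f|, F) : f ∈ 𝒩(L, S, D, B)}`. -/
def clippedNetwork (d : ℕ) (F : ℝ) (L S D : ℕ) (B : ℝ) : Set ((Fin d → ℝ) → ℝ) :=
  (fun f x => Real.sign (f x) * min |f x| F) '' network d L S D B

/-- The conditions on the parameters under which `𝒩(L, S, D, B)` is considered. -/
def Admissible (d L S D : ℕ) (B : ℝ) : Prop := 0 < L ∧ 0 < S ∧ 0 < D ∧ d ≤ D ∧ 1 ≤ B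

/-- `AP(C₁, C₂)`: functions in `L²([0,1]^d)` that, for each `0 < ε < 1/2`, are `ε`-approximable in
`L²([0,1]^d)` by a ReLU network with `L, S, D ≤ C₁ log (1/ε)` and `B ≤ C₂ / ε`. -/
def AP (d : ℕ) (C₁ C₂ : ℝ) : Set ((Fin d → ℝ) → ℝ) :=
  {φ | MemLp φ 2 (cubeMeasure d) ∧
    ∀ ε : ℝ, 0 < ε → ε < 1 / 2 →
      ∃ (L S D : ℕ) (B : ℝ), Admissible d L S D B ∧
        (L : ℝ) ≤ C₁ * Real.log (1 / ε) ∧ (S : ℝ) ≤ C₁ * Real.log (1 / ε) ∧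
        (D : ℝ) ≤ C₁ * Real.log (1 / ε) ∧ B ≤ C₂ / ε ∧
        ∃ g ∈ network d L S D B, eLpNorm (g - φ) 2 (cubeMeasure d) ≤ ENNReal.ofReal ε}

/-- The `ℓ⁰`-bounded affine class `I⁰_Φ(n_s, C)`. Functions on `[0,1]^d` are treated as `0`
outside `[0,1]^d`. The bound on `|det A|⁻¹` presupposes that `A` is invertible. -/
def affineClass {d : ℕ} (Φ : Set ((Fin d → ℝ) → ℝ)) (ns : ℕ) (C : ℝ) : Set ((Fin d → ℝ) → ℝ) :=
  {f | ∃ (c : Fin ns → ℝ) (φ : Fin ns → (Fin d → ℝ) → ℝ)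
      (A : Fin ns → Matrix (Fin d) (Fin d) ℝ) (b : Fin ns → Fin d → ℝ),
    (∀ i, φ i ∈ Φ ∧ (A i).det ≠ 0 ∧ |(A i).det|⁻¹ ≤ C ∧ (∀ j k, |A i j k| ≤ C) ∧
      (∀ j, |b i j| ≤ C) ∧ |c i| ≤ C) ∧
    f = fun x => ∑ i, c i * (cube d).indicator (φ i) (A i *ᵥ x - b i)}

/-- A sample `(X_i, Y_i)_{i=1}^n`. -/
abbrev Sample (d n : ℕ) : Type := Fin n → (Fin d → ℝ) × ℝ

/-- The law of `n` i.i.d. observations `Y_i = f°(X_i) + ξ_i`, with `X_i` uniform on `[0,1]^d` and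
`ξ_i` independent of `X_i`, centered Gaussian with variance `σ²`. -/
def sampleLaw (d n : ℕ) (σ : ℝ) (f₀ : (Fin d → ℝ) → ℝ) : Measure (Sample d n) :=
  Measure.pi fun _ =>
    ((cubeMeasure d).prod (gaussianReal 0 (σ ^ 2).toNNReal)).map fun p => (p.1, f₀ p.1 + p.2)

/-- The `L²` risk `E ‖f̂ - f°‖²_{L²}` of an estimator. -/
def risk {d n : ℕ} (σ : ℝ) (fhat : Sample d n → (Fin d → ℝ) → ℝ) (f₀ : (Fin d → ℝ) → ℝ) : ℝ≥0∞ :=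
  ∫⁻ z, eLpNorm (fhat z - f₀) 2 (cubeMeasure d) ^ 2 ∂(sampleLaw d n σ f₀)

/-- `fhat` is an empirical risk minimizer over `𝓕`: a measurable map from samples to elements
of `𝓕` (in the sense that all evaluations at points of the cube are measurable) which minimizes
the empirical squared error over `𝓕`. -/
def IsERM {d n : ℕ} (𝓕 : Set ((Fin d → ℝ) → ℝ)) (fhat : Sample d n → (Fin d → ℝ) → ℝ) : Prop :=
  (∀ x ∈ cube d, Measurable fun z => fhat z x) ∧
  ∀ z, fhat z ∈ 𝓕 ∧ ∀ g ∈ 𝓕,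
    (1 / n : ℝ) * ∑ i, (fhat z (z i).1 - (z i).2) ^ 2
      ≤ (1 / n : ℝ) * ∑ i, (g (z i).1 - (z i).2) ^ 2

end SparseReLU

end

noncomputable section

namespace SparseReLU

/-! The risk splits into an entropy term and an approximation term, both of order at most `(log n)^3
/ n`.

Statistics. For a fixed bounded `g` with `h = g - f°`, the excess loss at an observation is `h(X)^2
- 2 ξ h(X)`, with mean `‖h‖²`. Its fluctuations are controlled by the same mean, so for small `lam`
(depending on `σ` and `F` only) the variable `exp (lam (‖h‖²/4 - excess))` has expectation at most
one (`integral_exp_excess_le_one`). This self-bounding is what yields the rate `1/n` instead of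
`1/√n`. Over a finite net of `N` functions, independence and a soft maximum bound all the deviations
at once at the price `log N + 1` (`exists_majorant_of_exp_moments`), and comparing the minimizer
with its nearest net element gives the oracle inequality `risk_le_of_net`.

Entropy. A network is Lipschitz in its parameters on the cube, with constant about `(B (D + 1)) ^ (L
+ 1)`. Rounding at most `S` nonzero parameters to a grid therefore gives a `1/n`-net with `log N` of
order `S L log (B D)`. With `S, L, D` of order `log n` and `B` of order `n` this is `(log n)^3`.

Approximation. Networks approximating `φ` are uncontrolled outside the cube, whereas `φ` is extended
by zero. After composition with an affine map the output is thus truncated at the uniform bound `M`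
and pushed to zero by a penalty of slope `M n`, active from distance `1/n` inside the boundary
(`cutoff_mem_network`). Only a strip of volume `O(1/n)` is spoiled (`lintegral_cutoff_sub_le`), and
a change of variables and summation give squared error `O(1/n)`. The parameters `L n, S n, D n, B n`
are free up to constants, so they are chosen with enough slack for this construction to fit into the
prescribed class. -/

instance isProbabilityMeasure_cubeMeasure (d : ℕ) : IsProbabilityMeasure (cubeMeasure d) := by
  constructor
  simp [cubeMeasure, cube, Real.volume_Icc_pi]

theorem ae_mem_cube (d : ℕ) : ∀ᵐ x ∂(cubeMeasure d), x ∈ cube d :=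
  ae_restrict_mem measurableSet_Icc

/-! ### Exponential moments of the excess loss -/

theorem exp_neg_le_one_sub_half {u : ℝ} (h0 : 0 ≤ u) (h1 : u ≤ 1) :
    Real.exp (-u) ≤ 1 - u / 2 := by
  rw [Real.exp_neg, inv_le_iff_one_le_mul₀ (Real.exp_pos u)]
  have h := Real.quadratic_le_exp_of_nonneg h0
  have : 1 ≤ (1 - u / 2) * (1 + u + u ^ 2 / 2) := by nlinarith [mul_nonneg h0 h0]
  exact this.trans (mul_le_mul_of_nonneg_left h (by linarith))

/-- A majorant, with controlled mean, of finitely many sums of i.i.d. variables with exponential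
moments at most one. -/
theorem exists_majorant_of_exp_moments {Z T : Type*} [MeasurableSpace Z] [Fintype T] [Nonempty T]
    (P : Measure Z) [IsProbabilityMeasure P] (n : ℕ) (q : T → Z → ℝ)
    (hint : ∀ t, Integrable (fun z => Real.exp (q t z)) P)
    (hle : ∀ t, ∫ z, Real.exp (q t z) ∂P ≤ 1) :
    ∃ M : (Fin n → Z) → ℝ, Integrable M (Measure.pi fun _ => P) ∧
      ∫ z, M z ∂(Measure.pi fun _ => P) ≤ Real.log (Fintype.card T) + 1 ∧
      ∀ t z, ∑ i, q t (z i) ≤ M z := by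
  have hN : (0 : ℝ) < Fintype.card T := by exact_mod_cast Fintype.card_pos
  have hI : ∀ t, Integrable (fun z : Fin n → Z => ∏ i, Real.exp (q t (z i)))
      (Measure.pi fun _ => P) := fun t =>
    Integrable.fintype_prod (fun _ => hint t)
  have hS : Integrable (fun z : Fin n → Z => ∑ t, ∏ i, Real.exp (q t (z i)))
      (Measure.pi fun _ => P) := integrable_finsetSum _ fun t _ => hI t
  -- A smooth substitute for the maximum: `x ≤ log N + e^x / N`, which is `1 + y ≤ e^y` at `y = x -
  -- log N`. The average over `t` of the products has mean at most one by independence.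
  refine ⟨fun z => Real.log (Fintype.card T) +
    (∑ t, ∏ i, Real.exp (q t (z i))) / Fintype.card T, ?_, ?_, ?_⟩
  · exact (integrable_const _).add (hS.div_const _)
  · rw [integral_add (integrable_const _) (hS.div_const _), integral_div,
      integral_finsetSum _ fun t _ => hI t]
    have : ∑ t, ∫ z : Fin n → Z, ∏ i, Real.exp (q t (z i)) ∂(Measure.pi fun _ => P)
        ≤ ∑ _t : T, (1 : ℝ) := by
      refine Finset.sum_le_sum fun t _ => ?_
      rw [integral_fintype_prod_eq_prod (fun _ z => Real.exp (q t z))]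
      exact Finset.prod_le_one (fun _ _ => integral_nonneg fun _ => (Real.exp_pos _).le)
        fun _ _ => hle t
    have h2 : (∑ t, ∫ z : Fin n → Z, ∏ i, Real.exp (q t (z i)) ∂(Measure.pi fun _ => P)) /
        (Fintype.card T : ℝ) ≤ 1 := by
      rw [div_le_one hN]; simpa using this
    simpa using h2
  · intro t z
    have h1 : Real.exp (∑ i, q t (z i)) ≤ ∑ t, ∏ i, Real.exp (q t (z i)) := by
      rw [Real.exp_sum]
      exact Finset.single_le_sum (f := fun t => ∏ i, Real.exp (q t (z i)))
        (fun t _ => Finset.prod_nonneg fun _ _ => (Real.exp_pos _).le) (Finset.mem_univ t)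
    have h2 := Real.add_one_le_exp (∑ i, q t (z i) - Real.log (Fintype.card T))
    rw [Real.exp_sub, Real.exp_log hN] at h2
    have h3 := div_le_div_of_nonneg_right h1 hN.le
    linarith

section Gaussian

variable {X : Type*} [MeasurableSpace X] (μ : Measure X) [IsProbabilityMeasure μ]

theorem integral_exp_gaussian_tilt (σ c t : ℝ) :
    ∫ ξ, Real.exp (c + t * ξ) ∂(gaussianReal 0 (σ ^ 2).toNNReal)
      = Real.exp (c + σ ^ 2 * t ^ 2 / 2) := by
  have h := mgf_gaussianReal (p := gaussianReal 0 (σ ^ 2).toNNReal) (X := id)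
    (μ := 0) (v := (σ ^ 2).toNNReal) (by simp) t
  simp only [mgf, id] at h
  simp_rw [Real.exp_add]
  rw [integral_const_mul, h]
  simp [Real.coe_toNNReal _ (sq_nonneg σ)]

/-- The term `-lam h²` only helps, and `|h| ≤ F` leaves `exp (2 lam F |ξ|)`, dominated by the sum of
the exponentials with either sign. -/
theorem integrable_exp_excess (σ lam a F : ℝ) (hl : 0 ≤ lam) {h : X → ℝ} (hm : Measurable h)
    (hF : ∀ x, |h x| ≤ F) :
    Integrable (fun p : X × ℝ => Real.exp (lam * (a - (h p.1 ^ 2 - 2 * p.2 * h p.1))))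
      (μ.prod (gaussianReal 0 (σ ^ 2).toNNReal)) := by
  have h1 : Integrable (fun p : X × ℝ => Real.exp (lam * a) *
      (Real.exp (2 * lam * F * p.2) + Real.exp (-(2 * lam * F) * p.2)))
      (μ.prod (gaussianReal 0 (σ ^ 2).toNNReal)) :=
    (((integrable_exp_mul_gaussianReal (2 * lam * F)).add
      (integrable_exp_mul_gaussianReal (-(2 * lam * F)))).const_mul _).comp_snd μ
  refine h1.mono' (by fun_prop) (Filter.Eventually.of_forall fun p => ?_)
  rw [Real.norm_of_nonneg (Real.exp_pos _).le]
  have hb : 2 * lam * h p.1 * p.2 ≤ 2 * lam * F * |p.2| := by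
    have := mul_le_mul (hF p.1) le_rfl (abs_nonneg p.2) ((abs_nonneg _).trans (hF p.1))
    rw [← abs_mul] at this
    nlinarith [le_abs_self (h p.1 * p.2)]
  have h2 : Real.exp (2 * lam * F * |p.2|) ≤
      Real.exp (2 * lam * F * p.2) + Real.exp (-(2 * lam * F) * p.2) := by
    rcases abs_cases p.2 with ⟨e, _⟩ | ⟨e, _⟩ <;> rw [e]
    · linarith [Real.exp_pos (-(2 * lam * F) * p.2)]
    · rw [show 2 * lam * F * -p.2 = -(2 * lam * F) * p.2 by ring]
      linarith [Real.exp_pos (2 * lam * F * p.2)]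
  refine le_trans ?_ (mul_le_mul_of_nonneg_left h2 (Real.exp_pos _).le)
  rw [← Real.exp_add]
  apply Real.exp_le_exp.mpr
  nlinarith [mul_nonneg hl (sq_nonneg (h p.1))]

/-- Integrating out the noise turns the cross term into `2 lam² σ² h²`, which costs at most half of
`lam h²` because `4 lam σ² ≤ 1`. The remaining `exp (-lam h² / 2)` is at most `1 - lam h² / 4`, as
`lam h² / 2 ≤ 1`. Its mean `1 - lam a` is at most `exp (-lam a)`, which cancels the prefactor; hence
the quarter in `a`. -/
theorem integral_exp_excess_le_one (σ lam F : ℝ) (hl : 0 ≤ lam)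
    (hlσ : 4 * lam * σ ^ 2 ≤ 1) (hlF : lam * F ^ 2 ≤ 2) {h : X → ℝ} (hm : Measurable h)
    (hF : ∀ x, |h x| ≤ F) :
    ∫ p : X × ℝ, Real.exp (lam * ((∫ x, h x ^ 2 ∂μ) / 4 - (h p.1 ^ 2 - 2 * p.2 * h p.1)))
      ∂(μ.prod (gaussianReal 0 (σ ^ 2).toNNReal)) ≤ 1 := by
  set a := (∫ x, h x ^ 2 ∂μ) / 4 with ha
  have hsq : ∀ x, h x ^ 2 ≤ F ^ 2 := fun x => sq_le_sq' (abs_le.mp (hF x)).1 (abs_le.mp (hF x)).2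
  have hint : Integrable (fun x => h x ^ 2) μ :=
    Integrable.of_bound (hm.pow_const 2).aestronglyMeasurable (F ^ 2)
      (Filter.Eventually.of_forall fun x => by
        rw [Real.norm_of_nonneg (sq_nonneg _)]; exact hsq x)
  have hE := integrable_exp_excess μ σ lam a F hl hm hF
  rw [integral_prod _ hE]
  have hinner : ∀ x, ∫ ξ, Real.exp (lam * (a - (h x ^ 2 - 2 * ξ * h x)))
      ∂(gaussianReal 0 (σ ^ 2).toNNReal) ≤ Real.exp (lam * a) * (1 - lam * h x ^ 2 / 4) := by
    intro x
    have e : ∀ ξ, lam * (a - (h x ^ 2 - 2 * ξ * h x))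
        = (lam * a - lam * h x ^ 2) + (2 * lam * h x) * ξ := fun ξ => by ring
    simp_rw [e]
    rw [integral_exp_gaussian_tilt]
    have hu0 : 0 ≤ lam * h x ^ 2 / 2 := by positivity
    have hu1 : lam * h x ^ 2 / 2 ≤ 1 := by
      have := mul_le_mul_of_nonneg_left (hsq x) hl
      linarith
    have h3 := exp_neg_le_one_sub_half hu0 hu1
    have h4 : Real.exp (lam * a - lam * h x ^ 2 + σ ^ 2 * (2 * lam * h x) ^ 2 / 2)
        ≤ Real.exp (lam * a + -(lam * h x ^ 2 / 2)) := by
      apply Real.exp_le_exp.mpr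
      have := mul_le_mul_of_nonneg_right hlσ (mul_nonneg hl (sq_nonneg (h x)))
      nlinarith
    refine h4.trans ?_
    rw [Real.exp_add]
    refine mul_le_mul_of_nonneg_left (h3.trans (le_of_eq ?_)) (Real.exp_pos _).le
    ring
  have hint2 : Integrable (fun x => Real.exp (lam * a) * (1 - lam * h x ^ 2 / 4)) μ :=
    ((integrable_const _).sub ((hint.const_mul lam).div_const 4)).const_mul _
  refine (integral_mono hE.integral_prod_left hint2 hinner).trans ?_
  rw [integral_const_mul, integral_sub (integrable_const _) ((hint.const_mul lam).div_const 4),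
    integral_div, integral_const_mul]
  have h5 : (1 : ℝ) - lam * (∫ x, h x ^ 2 ∂μ) / 4 ≤ Real.exp (-(lam * a)) := by
    have := Real.add_one_le_exp (-(lam * a))
    rw [ha] at this ⊢
    linarith
  have h6 := mul_le_mul_of_nonneg_left h5 (Real.exp_pos (lam * a)).le
  rw [← Real.exp_add, add_neg_cancel, Real.exp_zero] at h6
  simpa using h6

theorem integrable_sq_gaussian (σ : ℝ) :
    Integrable (fun x : ℝ => x ^ 2) (gaussianReal 0 (σ ^ 2).toNNReal) :=
  (memLp_id_gaussianReal 2).integrable_sq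

theorem integral_sq_gaussian (σ : ℝ) :
    ∫ x, x ^ 2 ∂(gaussianReal 0 (σ ^ 2).toNNReal) = σ ^ 2 := by
  have h := variance_of_integral_eq_zero (μ := gaussianReal 0 (σ ^ 2).toNNReal) (X := id)
    aemeasurable_id (by simp)
  rw [variance_id_gaussianReal] at h
  simpa [Real.coe_toNNReal _ (sq_nonneg σ)] using h.symm

theorem integrable_id_gaussian (σ : ℝ) :
    Integrable (fun x : ℝ => x) (gaussianReal 0 (σ ^ 2).toNNReal) :=
  memLp_one_iff_integrable.mp (memLp_id_gaussianReal 1)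

theorem integrable_excess (σ F : ℝ) {h : X → ℝ} (hm : Measurable h) (hF : ∀ x, |h x| ≤ F) :
    Integrable (fun p : X × ℝ => h p.1 ^ 2 - 2 * p.2 * h p.1)
      (μ.prod (gaussianReal 0 (σ ^ 2).toNNReal)) := by
  have hint : Integrable h μ := Integrable.of_bound hm.aestronglyMeasurable F
      (Filter.Eventually.of_forall hF)
  have hint2 : Integrable (fun x => h x ^ 2) μ :=
    Integrable.of_bound (hm.pow_const 2).aestronglyMeasurable (F ^ 2)
      (Filter.Eventually.of_forall fun x => by
        rw [Real.norm_of_nonneg (sq_nonneg _)]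
        exact sq_le_sq' (abs_le.mp (hF x)).1 (abs_le.mp (hF x)).2)
  have h2 := (hint.mul_prod ((integrable_id_gaussian σ).const_mul 2))
  refine (hint2.comp_fst _).sub (h2.congr (Filter.Eventually.of_forall fun p => ?_))
  simp only; ring

theorem integral_excess (σ F : ℝ) {h : X → ℝ} (hm : Measurable h) (hF : ∀ x, |h x| ≤ F) :
    ∫ p : X × ℝ, (h p.1 ^ 2 - 2 * p.2 * h p.1) ∂(μ.prod (gaussianReal 0 (σ ^ 2).toNNReal))
      = ∫ x, h x ^ 2 ∂μ := by
  rw [integral_prod _ (integrable_excess μ σ F hm hF)]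
  refine integral_congr_ae (Filter.Eventually.of_forall fun x => ?_)
  simp only
  rw [integral_sub (integrable_const _)
    (((integrable_id_gaussian σ).const_mul 2).mul_const (h x))]
  rw [integral_mul_const, integral_const_mul, integral_id_gaussianReal]
  simp

end Gaussian

/-! ### The oracle inequality over a finite net -/

theorem eLpNorm_two_sq {X : Type*} [MeasurableSpace X] (μ : Measure X) (f : X → ℝ) :
    eLpNorm f 2 μ ^ 2 = ∫⁻ x, ENNReal.ofReal (f x ^ 2) ∂μ := by
  rw [eLpNorm_eq_lintegral_rpow_enorm_toReal (by norm_num) (by norm_num)]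
  simp only [ENNReal.toReal_ofNat, ENNReal.rpow_ofNat, one_div]
  rw [← ENNReal.rpow_natCast, ← ENNReal.rpow_mul]
  norm_num
  refine lintegral_congr fun x => ?_
  rw [← ofReal_norm, ← ENNReal.ofReal_pow (norm_nonneg _), Real.norm_eq_abs, sq_abs]

/-- Price of replacing an estimator by a net element. With `w = f°(X)` the difference `y - w` is the
noise, and `2 |y - w| ≤ 1 + (y - w)^2` leaves a bound independent of `u` and `v`, with a known mean.
-/
theorem abs_sub_sq_sub_sq_le {u v y w F δ : ℝ} (hu : |u| ≤ F) (hv : |v| ≤ F) (hw : |w| ≤ F)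
    (huv : |u - v| ≤ δ) :
    (v - y) ^ 2 - (u - y) ^ 2 ≤ δ * (4 * F + 1 + (y - w) ^ 2) := by
  have h1 : (v - y) ^ 2 - (u - y) ^ 2 ≤ |u - v| * |(v - w) + (u - w) - 2 * (y - w)| := by
    rw [← abs_mul, ← abs_neg]
    refine le_trans (le_of_eq ?_) (le_abs_self _)
    ring
  have h2 : |(v - w) + (u - w) - 2 * (y - w)| ≤ 4 * F + 1 + (y - w) ^ 2 := by
    rw [abs_le] at *
    constructor <;> nlinarith [sq_nonneg (y - w - 1), sq_nonneg (y - w + 1)]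
  exact h1.trans (mul_le_mul huv h2 (abs_nonneg _) ((abs_nonneg _).trans huv))

/-- Oracle inequality for empirical risk minimizers over a class with a finite uniform net. -/
theorem risk_le_of_net {d n : ℕ} (hn : 0 < n) {σ F δ lam : ℝ} (hl : 0 < lam)
    (hlσ : 4 * lam * σ ^ 2 ≤ 1) (hlF : lam * (2 * F) ^ 2 ≤ 2)
    {T : Type*} [Fintype T] [Nonempty T] (net : T → (Fin d → ℝ) → ℝ)
    (hnm : ∀ t, Measurable (net t)) (hnF : ∀ t x, |net t x| ≤ F)
    (𝓕 : Set ((Fin d → ℝ) → ℝ)) (hF : ∀ f ∈ 𝓕, ∀ x, |f x| ≤ F)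
    (hcov : ∀ f ∈ 𝓕, ∃ t, ∀ x ∈ cube d, |f x - net t x| ≤ δ)
    {f₁ : (Fin d → ℝ) → ℝ} (hfm : Measurable f₁) (hfF : ∀ x, |f₁ x| ≤ F)
    {fs : (Fin d → ℝ) → ℝ} (hsm : Measurable fs) (hs : fs ∈ 𝓕)
    {fhat : Sample d n → (Fin d → ℝ) → ℝ} (hE : IsERM 𝓕 fhat) :
    risk σ fhat f₁ ≤ ENNReal.ofReal (2 * δ ^ 2 + 8 * ((Real.log (Fintype.card T) + 1) / (lam * n)
      + δ * (4 * F + 1 + σ ^ 2) + ∫ x, (fs x - f₁ x) ^ 2 ∂(cubeMeasure d))) := by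
  have hnR : (0 : ℝ) < n := by exact_mod_cast hn
  set P₀ := (cubeMeasure d).prod (gaussianReal 0 (σ ^ 2).toNNReal) with hP₀
  set Ψ : (Fin d → ℝ) × ℝ → (Fin d → ℝ) × ℝ := fun p => (p.1, f₁ p.1 + p.2) with hΨ
  have hΨm : Measurable Ψ := by fun_prop
  set P := P₀.map Ψ with hP
  have : IsProbabilityMeasure P := Measure.isProbabilityMeasure_map hΨm.aemeasurable
  -- the excess loss at an observation
  set r : ((Fin d → ℝ) → ℝ) → (Fin d → ℝ) × ℝ → ℝ :=
    fun g z => (g z.1 - z.2) ^ 2 - (f₁ z.1 - z.2) ^ 2 with hr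
  have hrΨ : ∀ g p, r g (Ψ p) = (g p.1 - f₁ p.1) ^ 2 - 2 * p.2 * (g p.1 - f₁ p.1) := by
    intro g p; simp only [hr, hΨ]; ring
  have h2F : ∀ g : (Fin d → ℝ) → ℝ, (∀ x, |g x| ≤ F) → ∀ x, |g x - f₁ x| ≤ 2 * F := by
    intro g hg x
    have := abs_sub (g x) (f₁ x)
    linarith [hg x, hfF x]
  have hrm : ∀ g, Measurable g → Measurable (r g) := fun g hg => by simp only [hr]; fun_prop
  set a : T → ℝ := fun t => (∫ x, (net t x - f₁ x) ^ 2 ∂(cubeMeasure d)) / 4 with ha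
  have hqm : ∀ t, Measurable fun z => Real.exp (lam * (a t - r (net t) z)) := fun t => by
    have := hrm _ (hnm t)
    fun_prop
  have hq : ∀ t, Integrable (fun z => Real.exp (lam * (a t - r (net t) z))) P := by
    intro t
    rw [hP, integrable_map_measure (hqm t).aestronglyMeasurable hΨm.aemeasurable]
    refine (integrable_exp_excess (cubeMeasure d) σ lam (a t) (2 * F) hl.le ((hnm t).sub hfm)
      (h2F _ (hnF t))).congr (Filter.Eventually.of_forall fun p => ?_)
    simp [Function.comp, hrΨ]
  have hq1 : ∀ t, ∫ z, Real.exp (lam * (a t - r (net t) z)) ∂P ≤ 1 := by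
    intro t
    rw [hP, integral_map hΨm.aemeasurable (hqm t).aestronglyMeasurable]
    simp_rw [hrΨ]
    exact integral_exp_excess_le_one (cubeMeasure d) σ lam (2 * F) hl.le hlσ hlF
      ((hnm t).sub hfm) (h2F _ (hnF t))
  obtain ⟨M, hMi, hM1, hM⟩ := exists_majorant_of_exp_moments P n _ hq hq1
  -- the remaining, single-observation terms
  set w : (Fin d → ℝ) × ℝ → ℝ :=
    fun z => δ * (4 * F + 1 + (z.2 - f₁ z.1) ^ 2) + r fs z with hw
  have hwm : Measurable w := by
    have := hrm _ hsm
    simp only [hw]; fun_prop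
  have hwΨ : ∀ p, w (Ψ p) = δ * (4 * F + 1 + p.2 ^ 2)
      + ((fs p.1 - f₁ p.1) ^ 2 - 2 * p.2 * (fs p.1 - f₁ p.1)) := by
    intro p
    rw [hw]
    simp only [hrΨ]
    simp [hΨ]
  have hsqi : Integrable (fun p : (Fin d → ℝ) × ℝ => p.2 ^ 2) P₀ :=
    (integrable_sq_gaussian σ).comp_snd _
  have hA : Integrable (fun p : (Fin d → ℝ) × ℝ => δ * (4 * F + 1 + p.2 ^ 2)) P₀ :=
    ((integrable_const _).add hsqi).const_mul δ
  have hB := integrable_excess (cubeMeasure d) σ (2 * F) (hsm.sub hfm) (h2F _ (hF fs hs))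
  have hwi : Integrable w P := by
    rw [hP, integrable_map_measure hwm.aestronglyMeasurable hΨm.aemeasurable]
    refine (hA.add hB).congr (Filter.Eventually.of_forall fun p => ?_)
    simp [Function.comp, hwΨ]
  have hwint : ∫ z, w z ∂P = δ * (4 * F + 1 + σ ^ 2)
      + ∫ x, (fs x - f₁ x) ^ 2 ∂(cubeMeasure d) := by
    rw [hP, integral_map hΨm.aemeasurable hwm.aestronglyMeasurable]
    simp_rw [hwΨ]
    have hB' := integral_excess (cubeMeasure d) σ (2 * F) (hsm.sub hfm) (h2F _ (hF fs hs))
    simp only [Pi.sub_apply] at hB hB'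
    rw [integral_add hA hB, hB', integral_const_mul, integral_add (integrable_const _) hsqi]
    congr 3
    · simp
    · rw [hP₀, integral_fun_snd (μ := cubeMeasure d) (fun y : ℝ => y ^ 2), integral_sq_gaussian]
      simp
  have hwe : ∀ i : Fin n, Integrable (fun z : Sample d n => w (z i)) (Measure.pi fun _ => P) :=
    fun i => integrable_comp_eval (μ := fun _ : Fin n => P) hwi
  set R : Sample d n → ℝ := fun z =>
    2 * δ ^ 2 + 8 * (M z / (lam * n) + (∑ i, w (z i)) / n) with hR
  have hRi : Integrable R (Measure.pi fun _ => P) :=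
    (integrable_const _).add (((hMi.div_const _).add
      ((integrable_finsetSum _ fun i _ => hwe i).div_const _)).const_mul 8)
  -- the pointwise bound
  have hcubeP : ∀ᵐ z ∂P, z.1 ∈ cube d := by
    rw [hP, ae_map_iff hΨm.aemeasurable
      (measurable_fst measurableSet_Icc : MeasurableSet {z : (Fin d → ℝ) × ℝ | z.1 ∈ cube d})]
    exact Measure.quasiMeasurePreserving_fst.ae (ae_mem_cube d)
  have hcubeS : ∀ᵐ z ∂(Measure.pi fun _ : Fin n => P), ∀ i, (z i).1 ∈ cube d :=
    ae_all_iff.mpr fun i =>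
      (Measure.quasiMeasurePreserving_eval (μ := fun _ : Fin n => P) i).ae hcubeP
  have hpt : ∀ᵐ z ∂(Measure.pi fun _ : Fin n => P),
      eLpNorm (fhat z - f₁) 2 (cubeMeasure d) ^ 2 ≤ ENNReal.ofReal (R z) ∧ 0 ≤ R z := by
    filter_upwards [hcubeS] with z hz
    obtain ⟨hmem, hmin⟩ := hE.2 z
    obtain ⟨t, ht⟩ := hcov _ hmem
    have hmin' := hmin fs hs
    rw [mul_le_mul_iff_right₀ (by positivity)] at hmin'
    -- The index `t` depends on the sample, but the right side does not involve it: pass from the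
    -- net element to the minimizer at cost `δ`, then from the minimizer to the fixed comparison
    -- function `fs`.
    have h1 : ∑ i, r (net t) (z i) ≤ ∑ i, w (z i) := by
      have : ∑ i, (net t (z i).1 - (z i).2) ^ 2 ≤ ∑ i, ((fhat z (z i).1 - (z i).2) ^ 2
          + δ * (4 * F + 1 + ((z i).2 - f₁ (z i).1) ^ 2)) := by
        refine Finset.sum_le_sum fun i _ => ?_
        have := abs_sub_sq_sub_sq_le (y := (z i).2) (hF _ hmem (z i).1) (hnF t (z i).1)
          (hfF (z i).1) (ht _ (hz i))
        linarith
      simp only [hw, hr, Finset.sum_add_distrib, Finset.sum_sub_distrib] at this ⊢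
      linarith
    have h2 := hM t z
    have h3 : a t ≤ M z / (lam * n) + (∑ i, w (z i)) / n := by
      rw [← Finset.mul_sum, Finset.sum_sub_distrib] at h2
      simp only [Finset.sum_const, Finset.card_univ, Fintype.card_fin, nsmul_eq_mul] at h2
      have e : a t = (lam * (n * a t - ∑ i, r (net t) (z i))) / (lam * n)
          + (∑ i, r (net t) (z i)) / n := by
        field_simp; ring
      rw [e]
      gcongr
    -- The factor 8 is 2 from `(p + q)^2 ≤ 2 p^2 + 2 q^2` times 4 from the quarter in `a t`.
    have h4 : 2 * δ ^ 2 + 8 * a t ≤ R z := by simp only [hR]; linarith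
    have h0 : 0 ≤ a t := div_nonneg (integral_nonneg fun _ => sq_nonneg _) (by norm_num)
    refine ⟨?_, le_trans (by positivity) h4⟩
    have hsi : Integrable (fun x => (net t x - f₁ x) ^ 2) (cubeMeasure d) :=
      Integrable.of_bound (((hnm t).sub hfm).pow_const 2).aestronglyMeasurable ((2 * F) ^ 2)
        (Filter.Eventually.of_forall fun x => by
          rw [Real.norm_of_nonneg (sq_nonneg _)]
          have := abs_le.mp (h2F _ (hnF t) x)
          exact sq_le_sq' this.1 this.2)
    have hsi2 : Integrable (fun x => 2 * δ ^ 2 + 2 * (net t x - f₁ x) ^ 2) (cubeMeasure d) :=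
      (integrable_const _).add (hsi.const_mul 2)
    rw [eLpNorm_two_sq]
    calc ∫⁻ x, ENNReal.ofReal ((fhat z - f₁) x ^ 2) ∂(cubeMeasure d)
        ≤ ∫⁻ x, ENNReal.ofReal (2 * δ ^ 2 + 2 * (net t x - f₁ x) ^ 2) ∂(cubeMeasure d) := by
          refine lintegral_mono_ae ?_
          filter_upwards [ae_mem_cube d] with x hx
          apply ENNReal.ofReal_le_ofReal
          have h5 := ht x hx
          have h6 : (fhat z x - net t x) ^ 2 ≤ δ ^ 2 := sq_le_sq' (abs_le.mp h5).1 (abs_le.mp h5).2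
          simp only [Pi.sub_apply]
          nlinarith [sq_nonneg ((fhat z x - net t x) - (net t x - f₁ x))]
      _ = ENNReal.ofReal (∫ x, (2 * δ ^ 2 + 2 * (net t x - f₁ x) ^ 2) ∂(cubeMeasure d)) :=
          (ofReal_integral_eq_lintegral_ofReal hsi2
            (Filter.Eventually.of_forall fun x => by positivity)).symm
      _ ≤ ENNReal.ofReal (R z) := by
          apply ENNReal.ofReal_le_ofReal
          rw [integral_add (integrable_const _) (hsi.const_mul 2), integral_const, integral_const_mul]
          refine le_trans (le_of_eq ?_) h4
          simp only [ha, probReal_univ, smul_eq_mul, one_mul]; ring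
  have hfinal : ∫ z, R z ∂(Measure.pi fun _ : Fin n => P) ≤
      2 * δ ^ 2 + 8 * ((Real.log (Fintype.card T) + 1) / (lam * n)
      + δ * (4 * F + 1 + σ ^ 2) + ∫ x, (fs x - f₁ x) ^ 2 ∂(cubeMeasure d)) := by
    have hsum : ∫ z : Sample d n, ∑ i, w (z i) ∂(Measure.pi fun _ : Fin n => P)
        = n * ∫ z, w z ∂P := by
      rw [integral_finsetSum _ fun i _ => hwe i]
      simp_rw [integral_comp_eval (μ := fun _ : Fin n => P) hwi.aestronglyMeasurable]
      simp
    have hI1 := hMi.div_const (lam * n)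
    have hI2 := (integrable_finsetSum Finset.univ fun i _ => hwe i).div_const (n : ℝ)
    have hI3 := (hI1.add hI2).const_mul 8
    simp only [Pi.add_apply] at hI3
    simp only [hR]
    rw [integral_add (integrable_const _) hI3, integral_const, integral_const_mul, integral_add hI1 hI2, integral_div, integral_div, hsum, hwint]
    have : (∫ z, M z ∂(Measure.pi fun _ : Fin n => P)) / (lam * n)
        ≤ (Real.log (Fintype.card T) + 1) / (lam * n) := by gcongr
    rw [mul_div_cancel_left₀ _ hnR.ne']
    simp only [probReal_univ, smul_eq_mul, one_mul]
    linarith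
  calc risk σ fhat f₁ ≤ ∫⁻ z, ENNReal.ofReal (R z) ∂(Measure.pi fun _ : Fin n => P) :=
        lintegral_mono_ae (hpt.mono fun z hz => hz.1)
    _ = ENNReal.ofReal (∫ z, R z ∂(Measure.pi fun _ : Fin n => P)) :=
        (ofReal_integral_eq_lintegral_ofReal hRi (hpt.mono fun z hz => hz.2)).symm
    _ ≤ _ := ENNReal.ofReal_le_ofReal hfinal

/-- Members of the target class are only almost everywhere measurable and bounded; this permits
replacing them by measurable functions bounded everywhere. -/
theorem risk_congr {d n : ℕ} (σ : ℝ) (fhat : Sample d n → (Fin d → ℝ) → ℝ)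
    {f g : (Fin d → ℝ) → ℝ} (h : f =ᵐ[cubeMeasure d] g) : risk σ fhat f = risk σ fhat g := by
  have e : sampleLaw d n σ f = sampleLaw d n σ g := by
    unfold sampleLaw
    congr 1
    funext _
    refine Measure.map_congr ?_
    filter_upwards [Measure.quasiMeasurePreserving_fst.ae h] with p hp
    rw [hp]
  unfold risk
  rw [e]
  refine lintegral_congr fun z => ?_
  rw [eLpNorm_congr_ae (Filter.EventuallyEq.rfl.sub h)]

/-! ### Networks as functions of a parameter vector -/

theorem abs_relu_le (a : ℝ) : |relu a| ≤ |a| := by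
  rw [relu, abs_of_nonneg (le_max_right _ _)]
  exact max_le (le_abs_self a) (abs_nonneg a)

theorem abs_relu_sub_le (a b : ℝ) : |relu a - relu b| ≤ |a - b| :=
  abs_max_sub_max_le_abs a b 0

theorem continuous_relu : Continuous relu := continuous_id.max continuous_const

theorem continuous_hiddenLayer {d D : ℕ} (W₁ : Matrix (Fin D) (Fin d) ℝ)
    (W : ℕ → Matrix (Fin D) (Fin D) ℝ) (v : ℕ → Fin D → ℝ) (k : ℕ) :
    Continuous fun x => hiddenLayer W₁ W v x k := by
  induction k with
  | zero =>
    refine continuous_pi fun i => continuous_relu.comp (Continuous.sub ?_ continuous_const)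
    exact (continuous_apply i).comp (Continuous.matrix_mulVec continuous_const continuous_id)
  | succ k ih =>
    refine continuous_pi fun i => continuous_relu.comp (Continuous.sub ?_ continuous_const)
    exact (continuous_apply i).comp (Continuous.matrix_mulVec continuous_const ih)

theorem continuous_of_mem_network {d L S D : ℕ} {B : ℝ} {f : (Fin d → ℝ) → ℝ}
    (hf : f ∈ network d L S D B) : Continuous f := by
  obtain ⟨W₁, W, v, w, -, -, -, -, -, rfl⟩ := hf
  exact continuous_finsetSum _ fun i _ => continuous_const.mul
    ((continuous_apply i).comp (continuous_hiddenLayer W₁ W v _))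

theorem hiddenLayer_congr {d D : ℕ} {W₁ : Matrix (Fin D) (Fin d) ℝ}
    {W W' : ℕ → Matrix (Fin D) (Fin D) ℝ} {v v' : ℕ → Fin D → ℝ} {x : Fin d → ℝ} {k : ℕ}
    (hW : ∀ j < k, W j = W' j) (hv : ∀ j ≤ k, v j = v' j) :
    hiddenLayer W₁ W v x k = hiddenLayer W₁ W' v' x k := by
  induction k with
  | zero => simp only [hiddenLayer, hv 0 le_rfl]
  | succ k ih =>
    simp only [hiddenLayer, hv (k + 1) le_rfl, hW k (Nat.lt_succ_self k),
      ih (fun j hj => hW j (by omega)) (fun j hj => hv j (by omega))]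

/-- The number of nonzero entries, `0` or `1`, of a scalar. -/
def nz (a : ℝ) : ℕ := if a = 0 then 0 else 1

@[simp] theorem nz_zero : nz 0 = 0 := if_pos rfl

theorem nz_le_one (a : ℝ) : nz a ≤ 1 := by unfold nz; split_ifs <;> simp

@[simp] theorem nz_neg (a : ℝ) : nz (-a) = nz a := by simp [nz]

theorem nz_ite (p : Prop) [Decidable p] (a : ℝ) :
    nz (if p then a else 0) = if p then nz a else 0 := by
  split_ifs <;> simp

theorem card_filter_ne_zero {ι : Type*} [Fintype ι] (θ : ι → ℝ) [DecidablePred fun p => θ p ≠ 0] :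
    (Finset.univ.filter fun p => θ p ≠ 0).card = ∑ p, nz (θ p) := by
  rw [Finset.card_filter]
  refine Finset.sum_congr rfl fun p _ => ?_
  by_cases h : θ p = 0 <;> simp [nz, h]

theorem matNnz_eq_sum {m k : ℕ} (A : Matrix (Fin m) (Fin k) ℝ) :
    matNnz A = ∑ i, ∑ j, nz (A i j) := by
  rw [matNnz, Set.ncard_eq_toFinset_card', ← Fintype.sum_prod_type' (fun i j => nz (A i j)),
    ← card_filter_ne_zero fun p : Fin m × Fin k => A p.1 p.2]
  simp

theorem vecNnz_eq_sum {m : ℕ} (v : Fin m → ℝ) : vecNnz v = ∑ i, nz (v i) := by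
  rw [vecNnz, Set.ncard_eq_toFinset_card', ← card_filter_ne_zero v]
  simp

/-- Positions of the parameters of a network. -/
abbrev ParamIdx (d L D : ℕ) : Type :=
  (Fin D × Fin d) ⊕ (Fin (L - 1) × Fin D × Fin D) ⊕ (Fin L × Fin D) ⊕ Fin D

namespace ParamIdx

variable {d L D : ℕ} (θ : ParamIdx d L D → ℝ)

/-- The input weights. -/
def inputWeight : Matrix (Fin D) (Fin d) ℝ := fun i j => θ (Sum.inl (i, j))

/-- The weights between hidden layers. -/
def weight : ℕ → Matrix (Fin D) (Fin D) ℝ := fun k i j =>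
  if h : k < L - 1 then θ (Sum.inr (Sum.inl (⟨k, h⟩, i, j))) else 0

/-- The shifts. -/
def shift : ℕ → Fin D → ℝ := fun k i =>
  if h : k < L then θ (Sum.inr (Sum.inr (Sum.inl (⟨k, h⟩, i)))) else 0

/-- The output weights. -/
def outputWeight : Fin D → ℝ := fun i => θ (Sum.inr (Sum.inr (Sum.inr i)))

/-- The network with a given vector of parameters. -/
def realize (x : Fin d → ℝ) : ℝ :=
  ∑ i, outputWeight θ i * hiddenLayer (inputWeight θ) (weight θ) (shift θ) x (L - 1) i

theorem continuous_realize : Continuous (realize θ) :=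
  continuous_finsetSum _ fun i _ => continuous_const.mul
    ((continuous_apply i).comp (continuous_hiddenLayer _ _ _ _))

end ParamIdx

open ParamIdx

theorem exists_realize_of_mem_network {d L S D : ℕ} (hL : 0 < L) {B : ℝ} {f : (Fin d → ℝ) → ℝ}
    (hf : f ∈ network d L S D B) :
    ∃ θ : ParamIdx d L D → ℝ, (∀ p, |θ p| ≤ B) ∧
      (Finset.univ.filter fun p => θ p ≠ 0).card ≤ S ∧ f = realize θ := by
  obtain ⟨W₁, W, v, w, hW₁, hW, hv, hw, hS, rfl⟩ := hf
  refine ⟨Sum.elim (fun p => W₁ p.1 p.2) (Sum.elim (fun p => W p.1 p.2.1 p.2.2)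
    (Sum.elim (fun p => v p.1 p.2) w)), ?_, ?_, ?_⟩
  · rintro (p | p | p | p)
    · exact hW₁ _ _
    · exact hW _ p.1.2 _ _
    · exact hv _ p.1.2 _
    · exact hw _
  · refine le_trans (le_of_eq ?_) hS
    simp only [matNnz_eq_sum, vecNnz_eq_sum, Finset.sum_range, card_filter_ne_zero,
      Fintype.sum_sum_type, Fintype.sum_prod_type, Sum.elim_inl, Sum.elim_inr]
    ring
  · funext x
    unfold realize
    refine Finset.sum_congr rfl fun i _ => ?_
    congr 1
    refine congrFun (hiddenLayer_congr (fun j hj => ?_) (fun j hj => ?_)) i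
    · funext a b
      simp [weight, hj]
    · funext a
      simp [shift, show j < L by omega]

/-! ### Lipschitz dependence on the parameters -/

theorem abs_sum_mul_le {m : ℕ} {a x : Fin m → ℝ} {α β : ℝ}
    (hα : ∀ j, |a j| ≤ α) (hβ : ∀ j, |x j| ≤ β) : |∑ j, a j * x j| ≤ m * (α * β) := by
  calc |∑ j, a j * x j| ≤ ∑ j, |a j * x j| := Finset.abs_sum_le_sum_abs _ _
    _ ≤ ∑ _j : Fin m, α * β := Finset.sum_le_sum fun j _ => by
        rw [abs_mul]
        exact mul_le_mul (hα j) (hβ j) (abs_nonneg _) ((abs_nonneg _).trans (hα j))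
    _ = m * (α * β) := by simp

theorem abs_sum_mul_sub_le {m : ℕ} {a a' x x' : Fin m → ℝ} {η β B Δ : ℝ}
    (ha : ∀ j, |a j - a' j| ≤ η) (hx : ∀ j, |x j| ≤ β) (ha' : ∀ j, |a' j| ≤ B)
    (hx' : ∀ j, |x j - x' j| ≤ Δ) :
    |∑ j, a j * x j - ∑ j, a' j * x' j| ≤ m * (η * β) + m * (B * Δ) := by
  have e : ∑ j, a j * x j - ∑ j, a' j * x' j
      = ∑ j, (a j - a' j) * x j + ∑ j, a' j * (x j - x' j) := by
    rw [← Finset.sum_sub_distrib, ← Finset.sum_add_distrib]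
    exact Finset.sum_congr rfl fun j _ => by ring
  rw [e]
  exact (abs_add_le _ _).trans (add_le_add (abs_sum_mul_le ha hx) (abs_sum_mul_le ha' hx'))

theorem abs_le_one_of_mem_cube {d : ℕ} {x : Fin d → ℝ} (hx : x ∈ cube d) (j : Fin d) :
    |x j| ≤ 1 :=
  abs_le.mpr ⟨(by norm_num : (-1 : ℝ) ≤ 0).trans (hx.1 j), hx.2 j⟩

section Lipschitz

variable {d D : ℕ} {B : ℝ} (hB : 1 ≤ B) (hd : d ≤ D) {W₁ W₁' : Matrix (Fin D) (Fin d) ℝ}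
  {W W' : ℕ → Matrix (Fin D) (Fin D) ℝ} {v v' : ℕ → Fin D → ℝ} {x : Fin d → ℝ} (hx : x ∈ cube d)

include hB hd hx

theorem abs_hiddenLayer_le (hW₁ : ∀ i j, |W₁ i j| ≤ B) (hW : ∀ k i j, |W k i j| ≤ B)
    (hv : ∀ k i, |v k i| ≤ B) (k : ℕ) (i : Fin D) :
    |hiddenLayer W₁ W v x k i| ≤ (B * (D + 1)) ^ (k + 1) := by
  have hdR : (d : ℝ) ≤ D := by exact_mod_cast hd
  have hE : 1 ≤ B * (D + 1) := by nlinarith [Nat.cast_nonneg (α := ℝ) D]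
  induction k generalizing i with
  | zero =>
    refine (abs_relu_le _).trans ((abs_sub _ _).trans ?_)
    have h1 := abs_sum_mul_le (hW₁ i) (abs_le_one_of_mem_cube hx)
    have h2 := hv 0 i
    have h3 := mul_le_mul_of_nonneg_right hdR (zero_le_one.trans hB)
    simp only [Matrix.mulVec, dotProduct, zero_add, pow_one]
    linarith
  | succ k ih =>
    refine (abs_relu_le _).trans ((abs_sub _ _).trans ?_)
    have h1 := abs_sum_mul_le (hW k i) ih
    have h2 := hv (k + 1) i
    have h3 : 1 ≤ (B * (D + 1)) ^ (k + 1) := one_le_pow₀ hE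
    simp only [Matrix.mulVec, dotProduct]
    rw [pow_succ _ (k + 1)]
    nlinarith

/-- Each layer adds a fresh error, at most `η` times the size of its input plus the shift error, and
amplifies the inherited one by at most `D B`. With `E = B (D + 1)` each of the `k + 1` layers thus
contributes at most `η E ^ (k + 1)` in the end. -/
theorem abs_hiddenLayer_sub_le {η : ℝ} (hη : 0 ≤ η) (hW₁ : ∀ i j, |W₁ i j| ≤ B)
    (hW : ∀ k i j, |W k i j| ≤ B) (hv : ∀ k i, |v k i| ≤ B)
    (hW' : ∀ k i j, |W' k i j| ≤ B)
    (dW₁ : ∀ i j, |W₁ i j - W₁' i j| ≤ η) (dW : ∀ k i j, |W k i j - W' k i j| ≤ η)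
    (dv : ∀ k i, |v k i - v' k i| ≤ η) (k : ℕ) (i : Fin D) :
    |hiddenLayer W₁ W v x k i - hiddenLayer W₁' W' v' x k i|
      ≤ (k + 1) * (η * (B * (D + 1)) ^ (k + 1)) := by
  have hdR : (d : ℝ) ≤ D := by exact_mod_cast hd
  have hD : (0 : ℝ) ≤ D := Nat.cast_nonneg D
  have hE : 1 ≤ B * (D + 1) := by nlinarith
  induction k generalizing i with
  | zero =>
    refine (abs_relu_sub_le _ _).trans ?_
    -- Both networks read the same input, so the bound on `W₁'` is multiplied by `Δ = 0` and any
    -- bound will do.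
    have h1 := abs_sum_mul_sub_le (x' := x) (B := |B| + ∑ i, ∑ j, |W₁' i j|) (Δ := 0) (dW₁ i)
      (abs_le_one_of_mem_cube hx)
      (fun j => ((Finset.single_le_sum (f := fun j => |W₁' i j|) (fun _ _ => abs_nonneg _)
        (Finset.mem_univ j)).trans (Finset.single_le_sum (f := fun i => ∑ j, |W₁' i j|)
          (fun _ _ => Finset.sum_nonneg fun _ _ => abs_nonneg _) (Finset.mem_univ i))).trans
          (le_add_of_nonneg_left (abs_nonneg B)))
      (by simp)
    have h2 := dv 0 i
    simp only [Matrix.mulVec, dotProduct]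
    rw [sub_sub_sub_comm]
    refine (abs_sub _ _).trans ?_
    have h3 : η * d ≤ η * D := mul_le_mul_of_nonneg_left hdR hη
    have h4 : η * (D + 1) ≤ η * (D + 1) * B := le_mul_of_one_le_right (by positivity) hB
    simp only [mul_zero, add_zero, mul_one, Nat.cast_zero, zero_add, pow_one, one_mul] at h1 ⊢
    nlinarith
  | succ k ih =>
    refine (abs_relu_sub_le _ _).trans ?_
    have h1 := abs_sum_mul_sub_le (dW k i)
      (abs_hiddenLayer_le hB hd hx hW₁ hW hv k) (hW' k i) ih
    have h2 := dv (k + 1) i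
    have h3 : 1 ≤ (B * (D + 1)) ^ (k + 1) := one_le_pow₀ hE
    simp only [Matrix.mulVec, dotProduct]
    rw [sub_sub_sub_comm]
    refine (abs_sub _ _).trans ?_
    refine (add_le_add h1 h2).trans ?_
    set E := (B * (D + 1)) ^ (k + 1) with hEdef
    have h4 : η ≤ η * E := le_mul_of_one_le_right hη h3
    have h5 : η * E * (D + 1) ≤ η * E * (D + 1) * B := le_mul_of_one_le_right (by positivity) hB
    have h6 : 0 ≤ (k + 1) * (η * E) * B := by positivity
    rw [pow_succ _ (k + 1), ← hEdef]
    push_cast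
    nlinarith

end Lipschitz

theorem abs_realize_sub_le {d L D : ℕ} (hL : 0 < L) (hd : d ≤ D) {B η : ℝ} (hB : 1 ≤ B)
    (hη : 0 ≤ η) {θ θ' : ParamIdx d L D → ℝ} (h : ∀ p, |θ p| ≤ B) (h' : ∀ p, |θ' p| ≤ B)
    (hd' : ∀ p, |θ p - θ' p| ≤ η) {x : Fin d → ℝ} (hx : x ∈ cube d) :
    |realize θ x - realize θ' x| ≤ (L + 1) * (η * (B * (D + 1)) ^ (L + 1)) := by
  have hB0 : 0 ≤ B := by linarith
  have hD : (0 : ℝ) ≤ D := Nat.cast_nonneg D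
  have hE : 1 ≤ B * (D + 1) := by nlinarith
  have bW : ∀ k i j, |weight θ k i j| ≤ B := fun k i j => by
    unfold weight; split_ifs
    · exact h _
    · simpa using hB0
  have bW' : ∀ k i j, |weight θ' k i j| ≤ B := fun k i j => by
    unfold weight; split_ifs
    · exact h' _
    · simpa using hB0
  have bv : ∀ k i, |shift θ k i| ≤ B := fun k i => by
    unfold shift; split_ifs
    · exact h _
    · simpa using hB0
  have dW : ∀ k i j, |weight θ k i j - weight θ' k i j| ≤ η := fun k i j => by
    unfold weight; split_ifs
    · exact hd' _
    · simpa using hη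
  have dv : ∀ k i, |shift θ k i - shift θ' k i| ≤ η := fun k i => by
    unfold shift; split_ifs
    · exact hd' _
    · simpa using hη
  obtain ⟨l, rfl⟩ : ∃ l, L = l + 1 := ⟨L - 1, by omega⟩
  have h1 := abs_sum_mul_sub_le (a := outputWeight θ) (a' := outputWeight θ')
    (fun i => hd' _) (abs_hiddenLayer_le hB hd hx (W₁ := inputWeight θ) (fun i j => h _) bW bv l)
    (fun i => h' _)
    (abs_hiddenLayer_sub_le hB hd hx hη (W₁ := inputWeight θ) (W₁' := inputWeight θ')
      (fun i j => h _) bW bv bW' (fun i j => hd' _) dW dv l)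
  refine h1.trans ?_
  set E := (B * (D + 1)) ^ (l + 1) with hEdef
  have h3 : 1 ≤ E := one_le_pow₀ hE
  have h4 : η * E * D ≤ η * E * D * B := le_mul_of_one_le_right (by positivity) hB
  have h6 : 0 ≤ (l + 1) * (η * E) * B := by positivity
  have h7 : 0 ≤ η * E * B := by positivity
  rw [pow_succ _ (l + 1), ← hEdef]
  push_cast
  nlinarith

/-! ### Finite nets by rounding sparse parameters -/

/-- Rounding is towards zero, so the rounded parameters still obey the bound `B`. Grid indices are
offset by `⌊B / η⌋₊` to encode both signs. -/
theorem exists_grid_rounding {B η t : ℝ} (hη : 0 < η) (ht : |t| ≤ B) :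
    ∃ g : Fin (2 * ⌊B / η⌋₊ + 1), |t - η * ((g : ℝ) - ⌊B / η⌋₊)| ≤ η ∧
      |η * ((g : ℝ) - ⌊B / η⌋₊)| ≤ |t| := by
  set G := ⌊B / η⌋₊
  have h0 : 0 ≤ |t| / η := by positivity
  have hm : ⌊|t| / η⌋₊ ≤ G := Nat.floor_le_floor (by gcongr)
  have h1 := Nat.floor_le h0
  have h2 := Nat.lt_floor_add_one (|t| / η)
  set m := ⌊|t| / η⌋₊
  rw [le_div_iff₀ hη] at h1
  rw [div_lt_iff₀ hη] at h2
  have hmη : 0 ≤ (m : ℝ) * η := by positivity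
  rcases abs_cases t with ⟨e, _⟩ | ⟨e, _⟩
  · refine ⟨⟨G + m, by omega⟩, ?_, ?_⟩
    · rw [abs_le]; push_cast; constructor <;> nlinarith
    · push_cast
      rw [add_sub_cancel_left, abs_of_nonneg (by positivity)]; linarith
  · refine ⟨⟨G - m, by omega⟩, ?_, ?_⟩
    · rw [abs_le]; rw [Nat.cast_sub hm]; constructor <;> nlinarith
    · rw [Nat.cast_sub hm, sub_sub_cancel_left, mul_neg, abs_neg, abs_of_nonneg (by positivity)]
      linarith

/-- Codes of sparse parameter vectors with entries on a grid. -/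
abbrev SparseCode (I : Type) (S G : ℕ) : Type := Fin S → Option (I × Fin (2 * G + 1))

open Classical in
/-- The parameter vector with a given code, for mesh size `η`. -/
def SparseCode.decode {I : Type} {S G : ℕ} (η : ℝ) (c : SparseCode I S G) (p : I) : ℝ :=
  if h : ∃ g : Fin (2 * G + 1), ∃ s, c s = some (p, g) then η * ((h.choose : ℝ) - G) else 0

theorem exists_code {I : Type} [Fintype I] {S : ℕ} {B η : ℝ} (hη : 0 < η) {θ : I → ℝ}
    (hθ : ∀ p, |θ p| ≤ B) (hS : (Finset.univ.filter fun p => θ p ≠ 0).card ≤ S) :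
    ∃ c : SparseCode I S ⌊B / η⌋₊, ∀ p, |θ p - c.decode η p| ≤ η ∧ |c.decode η p| ≤ |θ p| := by
  classical
  choose g hg1 hg2 using fun p => exists_grid_rounding hη (hθ p)
  set l := (Finset.univ.filter fun p => θ p ≠ 0).toList with hl
  -- The slots list the support of `θ`, and slots past its end are `none`. The stored value depends
  -- on the position alone, so the choice made in `decode` is unambiguous.
  refine ⟨fun s => (l[(s : ℕ)]?).map fun p => (p, g p), fun p => ?_⟩
  by_cases h : ∃ g' : Fin (2 * ⌊B / η⌋₊ + 1), ∃ s : Fin S,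
      ((l[(s : ℕ)]?).map fun p => (p, g p)) = some (p, g')
  · have e : h.choose = g p := by
      obtain ⟨s, hs⟩ := h.choose_spec
      rw [Option.map_eq_some_iff] at hs
      obtain ⟨q, -, hq⟩ := hs
      rw [Prod.mk.injEq] at hq
      rw [← hq.2, hq.1]
    rw [SparseCode.decode, dif_pos h, e]
    exact ⟨hg1 p, hg2 p⟩
  · rw [SparseCode.decode, dif_neg h]
    have h0 : θ p = 0 := by
      by_contra hne
      have hp : p ∈ l := by simp [hl, hne]
      obtain ⟨i, hi, hip⟩ := List.getElem_of_mem hp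
      have hlS : l.length ≤ S := by rw [hl, Finset.length_toList]; exact hS
      exact h ⟨g p, ⟨i, hi.trans_le hlS⟩, by simp [List.getElem?_eq_getElem hi, hip]⟩
    simp [h0, hη.le]

/-- A finite uniform net for the class of sparse networks. -/
theorem exists_net_network {d L S D : ℕ} (hL : 0 < L) (hd : d ≤ D) {B η : ℝ} (hB : 1 ≤ B)
    (hη : 0 < η) {f : (Fin d → ℝ) → ℝ} (hf : f ∈ network d L S D B) :
    ∃ c : SparseCode (ParamIdx d L D) S ⌊B / η⌋₊, ∀ x ∈ cube d,
      |f x - realize (c.decode η) x| ≤ (L + 1) * (η * (B * (D + 1)) ^ (L + 1)) := by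
  obtain ⟨θ, hθ, hS, rfl⟩ := exists_realize_of_mem_network hL hf
  obtain ⟨c, hc⟩ := exists_code hη hθ hS
  exact ⟨c, fun x hx => abs_realize_sub_le hL hd hB hη.le hθ
    (fun p => (hc p).2.trans (hθ p)) (fun p => (hc p).1) hx⟩

theorem card_sparseCode {d L S D : ℕ} (G : ℕ) :
    Fintype.card (SparseCode (ParamIdx d L D) S G)
      = ((D * d + ((L - 1) * (D * D) + (L * D + D))) * (2 * G + 1) + 1) ^ S := by
  simp

/-! ### A calculus for assembling networks layer by layer -/

/-- The number of nonzero parameters of an affine map. -/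
def affineCost {ι κ : Type} [Fintype ι] [Fintype κ] (W : κ → ι → ℝ) (v : κ → ℝ) : ℕ :=
  ∑ i, ∑ j, nz (W i j) + ∑ i, nz (v i)

/-- `Hidden D B k s h`: the vector-valued function `h` is the output of the `k+1`-st hidden layer
of a network whose layers, indexed by arbitrary finite types, have at most `D` units, with at most
`s` nonzero parameters, all bounded by `B`. -/
inductive Hidden {d : ℕ} (D : ℕ) (B : ℝ) :
    ℕ → ℕ → {ι : Type} → ((Fin d → ℝ) → ι → ℝ) → Prop
  | first {ι : Type} [Fintype ι] {h : (Fin d → ℝ) → ι → ℝ} {s : ℕ} (W : ι → Fin d → ℝ) (v : ι → ℝ)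
      (hι : Fintype.card ι ≤ D) (hW : ∀ i j, |W i j| ≤ B) (hv : ∀ i, |v i| ≤ B)
      (hs : affineCost W v ≤ s) (hh : ∀ x i, h x i = relu (∑ j, W i j * x j - v i)) :
      Hidden D B 0 s h
  | next {ι κ : Type} [Fintype ι] [Fintype κ] {k s s' : ℕ} {h : (Fin d → ℝ) → ι → ℝ}
      {h' : (Fin d → ℝ) → κ → ℝ} (H : Hidden D B k s h) (W : κ → ι → ℝ) (v : κ → ℝ)
      (hκ : Fintype.card κ ≤ D) (hW : ∀ i j, |W i j| ≤ B) (hv : ∀ i, |v i| ≤ B)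
      (hs : s + affineCost W v ≤ s') (hh : ∀ x i, h' x i = relu (∑ j, W i j * h x j - v i)) :
      Hidden D B (k + 1) s' h'

/-- Used twice over: with `F` counting nonzero entries, padding is free of cost; with `F`
multiplying by an input, padding does not change the value. -/
theorem sum_extend {ι κ M : Type*} [Fintype ι] [Fintype κ] [AddCommMonoid M] {e : ι → κ}
    (he : Function.Injective e) (w : ι → ℝ) (F : ℝ → κ → M) (hF : ∀ b, F 0 b = 0) :
    ∑ b, F (Function.extend e w 0 b) b = ∑ i, F (w i) (e i) := by
  symm
  refine Fintype.sum_of_injective e he _ _ (fun b hb => ?_) (fun i => ?_)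
  · rw [Function.extend_apply' _ _ _ (by simpa using hb)]
    exact hF b
  · rw [he.extend_apply]

theorem abs_extend_le {ι κ : Type*} {e : ι → κ} (he : Function.Injective e) {w : ι → ℝ} {B : ℝ}
    (hB : 0 ≤ B) (hw : ∀ i, |w i| ≤ B) (b : κ) : |Function.extend e w 0 b| ≤ B := by
  by_cases hb : ∃ a, e a = b
  · obtain ⟨a, rfl⟩ := hb
    rw [he.extend_apply]; exact hw a
  · rw [Function.extend_apply' _ _ _ hb]; simpa using hB

/-- A matrix padded with zeros along injections of the index types. -/
def padMatrix {ι κ : Type} {m k : ℕ} (e : ι → Fin m) (e' : κ → Fin k) (W : ι → κ → ℝ) :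
    Matrix (Fin m) (Fin k) ℝ :=
  fun a b => Function.extend e (fun i => Function.extend e' (W i) 0 b) 0 a

section padMatrix

variable {ι κ : Type} {m k : ℕ} {e : ι → Fin m} {e' : κ → Fin k} (he : Function.Injective e)
  (he' : Function.Injective e') (W : ι → κ → ℝ)

include he

theorem padMatrix_apply (i : ι) (b : Fin k) :
    padMatrix e e' W (e i) b = Function.extend e' (W i) 0 b := by
  rw [padMatrix, he.extend_apply]

include he'

theorem abs_padMatrix_le {B : ℝ} (hB : 0 ≤ B) (hW : ∀ i j, |W i j| ≤ B) (a : Fin m) (b : Fin k) :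
    |padMatrix e e' W a b| ≤ B :=
  abs_extend_le he hB (fun i => abs_extend_le he' hB (hW i) b) a

theorem matNnz_padMatrix [Fintype ι] [Fintype κ] :
    matNnz (padMatrix e e' W) = ∑ i, ∑ j, nz (W i j) := by
  rw [matNnz_eq_sum, Finset.sum_comm]
  simp only [padMatrix]
  rw [Finset.sum_congr rfl fun b _ => sum_extend he _ (fun t _ => nz t) fun _ => nz_zero,
    Finset.sum_comm]
  exact Finset.sum_congr rfl fun i _ => sum_extend he' _ (fun t _ => nz t) fun _ => nz_zero

theorem padMatrix_mulVec [Fintype κ] {x : Fin k → ℝ} {y : κ → ℝ} (hxy : ∀ j, x (e' j) = y j)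
    (i : ι) : (padMatrix e e' W *ᵥ x) (e i) = ∑ j, W i j * y j := by
  simp only [Matrix.mulVec, dotProduct, padMatrix_apply he]
  rw [sum_extend he' _ (fun t b => t * x b) fun _ => zero_mul _]
  simp [hxy]

end padMatrix

theorem vecNnz_extend {ι : Type} [Fintype ι] {m : ℕ} {e : ι → Fin m} (he : Function.Injective e)
    (v : ι → ℝ) : vecNnz (Function.extend e v 0) = ∑ i, nz (v i) := by
  rw [vecNnz_eq_sum]
  exact sum_extend he v (fun t _ => nz t) fun _ => nz_zero

theorem exists_injective_fin {ι : Type} [Fintype ι] {D : ℕ} (h : Fintype.card ι ≤ D) :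
    ∃ e : ι → Fin D, Function.Injective e :=
  ⟨fun i => Fin.castLE h (Fintype.equivFin ι i),
    (Fin.castLE_injective h).comp (Fintype.equivFin ι).injective⟩

/-- Each index type is embedded in `Fin D` and all other entries are set to zero. The embeddings of
different layers are unrelated, since each weight matrix is padded along its own source and target.
-/
theorem Hidden.exists_hiddenLayer {d D : ℕ} {B : ℝ} (hB : 0 ≤ B) {k s : ℕ} {ι : Type}
    {h : (Fin d → ℝ) → ι → ℝ} (H : Hidden D B k s h) :
    ∃ (e : ι → Fin D) (W₁ : Matrix (Fin D) (Fin d) ℝ) (W : ℕ → Matrix (Fin D) (Fin D) ℝ)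
      (v : ℕ → Fin D → ℝ), Function.Injective e ∧ (∀ i j, |W₁ i j| ≤ B) ∧
      (∀ l i j, |W l i j| ≤ B) ∧ (∀ l i, |v l i| ≤ B) ∧
      matNnz W₁ + ∑ l ∈ Finset.range k, matNnz (W l)
        + ∑ l ∈ Finset.range (k + 1), vecNnz (v l) ≤ s ∧
      ∀ x i, hiddenLayer W₁ W v x k (e i) = h x i := by
  induction H with
  | @first ι _ h s W v hι hW hv hs hh =>
    obtain ⟨e, he⟩ := exists_injective_fin hι
    refine ⟨e, padMatrix e id W, 0, fun _ => Function.extend e v 0, he,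
      abs_padMatrix_le he Function.injective_id W hB hW, fun _ _ _ => by simpa using hB,
      fun _ => abs_extend_le he hB hv, ?_, fun x i => ?_⟩
    · rw [matNnz_padMatrix he Function.injective_id]
      simpa [vecNnz_extend he, affineCost] using hs
    · rw [hh]
      simp only [hiddenLayer]
      rw [padMatrix_mulVec he Function.injective_id W (y := x) (fun _ => rfl), he.extend_apply]
  | @next ι κ _ _ k s s' h h' H W v hκ hW hv hs hh ih =>
    obtain ⟨e, W₁, W', v', he, bW₁, bW, bv, hcost, hval⟩ := ih
    obtain ⟨e', he'⟩ := exists_injective_fin hκ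
    -- The first `k + 1` layers use only weights below `k` and shifts up to `k`, so the next slots
    -- are free to overwrite.
    have eW : ∀ l < k, Function.update W' k (padMatrix e' e W) l = W' l := fun l hl =>
      Function.update_of_ne hl.ne _ _
    have ev : ∀ l ≤ k, Function.update v' (k + 1) (Function.extend e' v 0) l = v' l := fun l hl =>
      Function.update_of_ne (by omega) _ _
    refine ⟨e', W₁, Function.update W' k (padMatrix e' e W),
      Function.update v' (k + 1) (Function.extend e' v 0), he', bW₁, fun l i j => ?_,
      fun l i => ?_, ?_, fun x i => ?_⟩
    · rcases eq_or_ne l k with rfl | hl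
      · rw [Function.update_self]; exact abs_padMatrix_le he' he W hB hW i j
      · rw [Function.update_of_ne hl]; exact bW l i j
    · rcases eq_or_ne l (k + 1) with rfl | hl
      · rw [Function.update_self]; exact abs_extend_le he' hB hv i
      · rw [Function.update_of_ne hl]; exact bv l i
    · rw [Finset.sum_range_succ _ k, Finset.sum_range_succ _ (k + 1), Function.update_self,
        Function.update_self, matNnz_padMatrix he' he, vecNnz_extend he',
        Finset.sum_congr rfl fun l hl => congrArg matNnz (eW l (Finset.mem_range.mp hl)),
        Finset.sum_congr rfl fun l hl =>
          congrArg vecNnz (ev l (Nat.lt_succ_iff.mp (Finset.mem_range.mp hl)))]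
      unfold affineCost at hs
      rw [Nat.succ_eq_add_one]
      omega
    · rw [hh]
      simp only [hiddenLayer, Function.update_self]
      rw [he'.extend_apply, hiddenLayer_congr eW ev, padMatrix_mulVec he' he W (hval x)]

theorem Hidden.mem_network {d D : ℕ} {B : ℝ} (hB : 0 ≤ B) {k s S : ℕ} {ι : Type} [Fintype ι]
    {h : (Fin d → ℝ) → ι → ℝ} (H : Hidden D B k s h) (w : ι → ℝ) (hw : ∀ i, |w i| ≤ B)
    (hS : s + ∑ i, nz (w i) ≤ S) {f : (Fin d → ℝ) → ℝ} (hf : ∀ x, f x = ∑ i, w i * h x i) :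
    f ∈ network d (k + 1) S D B := by
  obtain ⟨e, W₁, W, v, he, bW₁, bW, bv, hcost, hval⟩ := H.exists_hiddenLayer hB
  refine ⟨W₁, W, v, Function.extend e w 0, bW₁, fun l _ => bW l, fun l _ => bv l,
    abs_extend_le he hB hw, ?_, ?_⟩
  · rw [vecNnz_extend he, Nat.add_sub_cancel]
    omega
  · funext x
    rw [hf, sum_extend he w (fun t b => t * hiddenLayer W₁ W v x (k + 1 - 1) b)
      fun _ => zero_mul _]
    simp [hval]

/-- On nonnegative values the ReLU is the identity, so layers with identity weights add depth for
one parameter per unit. -/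
theorem Hidden.carry {d D : ℕ} {B : ℝ} (hB : 1 ≤ B) {k s : ℕ} {ι : Type} [Fintype ι]
    {h : (Fin d → ℝ) → ι → ℝ} (H : Hidden D B k s h) (hι : Fintype.card ι ≤ D)
    (h0 : ∀ x i, 0 ≤ h x i) (m : ℕ) : Hidden D B (k + m) (s + m * Fintype.card ι) h := by
  classical
  induction m with
  | zero => simpa using H
  | succ m ih =>
    refine Hidden.next ih (fun i j => if i = j then 1 else 0) 0 hι (fun i j => ?_) (fun i => ?_) ?_
      (fun x i => ?_)
    · split_ifs
      · simpa using hB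
      · simpa using zero_le_one.trans hB
    · simpa using zero_le_one.trans hB
    · simp only [affineCost, nz_ite, Finset.sum_ite_eq, Finset.mem_univ, if_true, Pi.zero_apply,
        nz_zero, Finset.sum_const_zero, add_zero]
      have : ∑ _i : ι, nz 1 ≤ Fintype.card ι := by
        refine (Finset.sum_le_card_nsmul _ _ 1 fun _ _ => nz_le_one _).trans (by simp)
      nlinarith
    · simp [relu, h0]

/-- A finite sum of networks of the same shape is a network. -/
theorem sum_mem_network {d L S D ns : ℕ} {B : ℝ} (hB : 0 ≤ B) {f : Fin ns → (Fin d → ℝ) → ℝ}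
    (hf : ∀ i, f i ∈ network d L S D B) :
    (fun x => ∑ i, f i x) ∈ network d L (ns * S) (ns * D) B := by
  choose W₁ W v w hW₁ hW hv hw hS hfx using hf
  set e : Fin ns × Fin D ≃ Fin (ns * D) := finProdFinEquiv with he
  have hsum : ∀ {M : Type} [AddCommMonoid M] (F : Fin (ns * D) → M),
      ∑ a, F a = ∑ i, ∑ j, F (e (i, j)) := fun F => by
    rw [← e.sum_comp, Fintype.sum_prod_type]
  set W₁' : Matrix (Fin (ns * D)) (Fin d) ℝ := fun a j => W₁ (e.symm a).1 (e.symm a).2 j with hW₁'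
  -- Block diagonal weights run the networks in parallel without interaction; the output row adds
  -- them.
  set W' : ℕ → Matrix (Fin (ns * D)) (Fin (ns * D)) ℝ := fun k a b =>
    if (e.symm a).1 = (e.symm b).1 then W (e.symm a).1 k (e.symm a).2 (e.symm b).2 else 0 with hW'
  set v' : ℕ → Fin (ns * D) → ℝ := fun k a => v (e.symm a).1 k (e.symm a).2 with hv'
  have hhid : ∀ x k i j, hiddenLayer W₁' W' v' x k (e (i, j))
      = hiddenLayer (W₁ i) (W i) (v i) x k j := by
    intro x k
    induction k with
    | zero => intro i j; simp [hiddenLayer, hW₁', hv', Matrix.mulVec, dotProduct]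
    | succ k ih =>
      intro i j
      rw [hiddenLayer, hiddenLayer]
      generalize hiddenLayer W₁' W' v' x k = H at ih
      simp only [hv', Matrix.mulVec, dotProduct, hsum, ih, hW', Equiv.symm_apply_apply, ite_mul,
        zero_mul]
      congr 2
      rw [Finset.sum_eq_single i (fun i' _ hne => by simp [hne.symm]) (by simp)]
      simp
  refine ⟨W₁', W', v', fun a => w (e.symm a).1 (e.symm a).2, fun _ _ => hW₁ _ _ _,
    fun k hk a b => ?_, fun k hk _ => hv _ k hk _, fun _ => hw _ _, ?_, ?_⟩
  · simp only [hW']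
    split_ifs
    · exact hW _ k hk _ _
    · simpa using hB
  · have e1 : matNnz W₁' = ∑ i, matNnz (W₁ i) := by
      rw [matNnz_eq_sum, hsum]
      simp [matNnz_eq_sum, hW₁']
    have e2 : ∀ k, matNnz (W' k) = ∑ i, matNnz (W i k) := by
      intro k
      rw [matNnz_eq_sum, hsum]
      simp only [matNnz_eq_sum, hsum, hW', Equiv.symm_apply_apply, nz_ite]
      refine Finset.sum_congr rfl fun i _ => Finset.sum_congr rfl fun j _ => ?_
      rw [Finset.sum_eq_single i (fun i' _ hne => by simp [hne.symm]) (by simp)]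
      simp
    have e3 : ∀ k, vecNnz (v' k) = ∑ i, vecNnz (v i k) := by
      intro k; simp [vecNnz_eq_sum, hsum, hv']
    have e4 : vecNnz (fun a => w (e.symm a).1 (e.symm a).2) = ∑ i, vecNnz (w i) := by
      simp [vecNnz_eq_sum, hsum]
    simp only [e1, e2, e3, e4]
    rw [Finset.sum_comm, Finset.sum_comm (s := Finset.range L), ← Finset.sum_add_distrib,
      ← Finset.sum_add_distrib, ← Finset.sum_add_distrib]
    exact (Finset.sum_le_card_nsmul _ _ S fun i _ => hS i).trans (by simp)
  · funext x
    simp only [hsum, hhid, Equiv.symm_apply_apply]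
    exact Finset.sum_congr rfl fun i _ => congrFun (hfx i) x

theorem relu_of_nonneg {a : ℝ} (h : 0 ≤ a) : relu a = a := max_eq_left h

theorem relu_of_nonpos {a : ℝ} (h : a ≤ 0) : relu a = 0 := max_eq_right h

theorem relu_nonneg (a : ℝ) : 0 ≤ relu a := le_max_right _ _

theorem relu_sub_relu_neg (a : ℝ) : relu a - relu (-a) = a := by
  rcases le_total 0 a with h | h
  · rw [relu_of_nonneg h, relu_of_nonpos (by linarith)]; ring
  · rw [relu_of_nonpos h, relu_of_nonneg (by linarith)]; ring

theorem network_mono {d L S S' D : ℕ} {B B' : ℝ} (hS : S ≤ S') (hB : B ≤ B') :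
    network d L S D B ⊆ network d L S' D B' := by
  rintro f ⟨W₁, W, v, w, h1, h2, h3, h4, h5, rfl⟩
  exact ⟨W₁, W, v, w, fun i j => (h1 i j).trans hB, fun k hk i j => (h2 k hk i j).trans hB,
    fun k hk i => (h3 k hk i).trans hB, fun i => (h4 i).trans hB, h5.trans hS, rfl⟩

/-- The sign attached to a Boolean. -/
def signOf (a : Bool) : ℝ := if a then 1 else -1

theorem abs_signOf (a : Bool) : |signOf a| = 1 := by cases a <;> simp [signOf]

theorem nz_signOf_mul (a : Bool) (t : ℝ) : nz (signOf a * t) = nz t := by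
  cases a <;> simp [signOf]

theorem affineCost_matrix {m k : ℕ} (W : Matrix (Fin m) (Fin k) ℝ) (v : Fin m → ℝ) :
    affineCost W v = matNnz W + vecNnz v := by
  rw [matNnz_eq_sum, vecNnz_eq_sum]
  rfl

theorem Hidden.of_hiddenLayer {d D D' : ℕ} {B : ℝ} {W₁ : Matrix (Fin D) (Fin d) ℝ}
    {W : ℕ → Matrix (Fin D) (Fin D) ℝ} {v : ℕ → Fin D → ℝ} (hD : D ≤ D') (k : ℕ)
    (hW₁ : ∀ i j, |W₁ i j| ≤ B) (hW : ∀ l < k, ∀ i j, |W l i j| ≤ B)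
    (hv : ∀ l < k + 1, ∀ i, |v l i| ≤ B) :
    Hidden D' B k (matNnz W₁ + ∑ l ∈ Finset.range k, matNnz (W l)
        + ∑ l ∈ Finset.range (k + 1), vecNnz (v l)) (fun x => hiddenLayer W₁ W v x k) := by
  induction k with
  | zero =>
    exact Hidden.first W₁ (v 0) (by simpa using hD) hW₁ (hv 0 (by omega))
      (by simp [affineCost, matNnz_eq_sum, vecNnz_eq_sum]) fun x i => rfl
  | succ k ih =>
    refine Hidden.next (ih (fun l hl => hW l (by omega)) (fun l hl => hv l (by omega))) (W k)
      (v (k + 1)) (by simpa using hD) (hW k (by omega)) (hv (k + 1) (by omega)) ?_ fun x i => rfl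
    rw [Finset.sum_range_succ (fun l => matNnz (W l)) k,
      Finset.sum_range_succ (fun l => vecNnz (v l)) (k + 1)]
    have := affineCost_matrix (W k) (v (k + 1))
    omega

/-- Every network is realized by deeper networks, at a cost linear in the depth. -/
theorem network_subset_of_depth_lt {d L S D L' S' D' : ℕ} {B : ℝ} (hB : 1 ≤ B) (hL : 0 < L)
    (hLL : L < L') (hD : D ≤ D') (hD2 : 2 ≤ D') (hS : 3 * S + 2 * L' + 2 ≤ S') :
    network d L S D B ⊆ network d L' S' D' B := by
  rintro f ⟨W₁, W, v, w, h1, h2, h3, h4, h5, rfl⟩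
  obtain ⟨l, rfl⟩ : ∃ l, L = l + 1 := ⟨L - 1, by omega⟩
  obtain ⟨m, rfl⟩ : ∃ m, L' = l + 1 + m + 1 := ⟨L' - l - 2, by omega⟩
  simp only [Nat.add_sub_cancel] at h2 h5 ⊢
  have H := Hidden.of_hiddenLayer hD l h1 h2 h3
  -- The output becomes a hidden layer holding its positive and negative parts, which can be
  -- carried. The output row is used twice, whence `3 * S`, and this conversion is why the depth
  -- must grow strictly.
  have H2 : Hidden D' B (l + 1) (3 * S) (fun x (a : Bool) =>
      relu (signOf a * ∑ i, w i * hiddenLayer W₁ W v x l i)) := by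
    refine Hidden.next H (fun a i => signOf a * w i) 0 (by simpa using hD2) (fun a i => ?_)
      (fun a => by simpa using zero_le_one.trans hB) ?_ fun x a => ?_
    · rw [abs_mul, abs_signOf, one_mul]; exact h4 i
    · simp only [affineCost, nz_signOf_mul, ← vecNnz_eq_sum, Pi.zero_apply, nz_zero,
        Finset.sum_const, Finset.card_univ, Fintype.card_bool, smul_eq_mul, mul_zero, add_zero]
      omega
    · simp [Finset.mul_sum, mul_assoc]
  have H3 := H2.carry hB (by simpa using hD2) (fun x a => relu_nonneg _) m
  refine H3.mem_network (zero_le_one.trans hB) signOf (fun a => (abs_signOf a).trans_le hB) ?_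
    fun x => ?_
  · have : ∑ a, nz (signOf a) ≤ 2 :=
      (Finset.sum_le_card_nsmul _ _ 1 fun a _ => nz_le_one _).trans (by simp)
    simp only [Fintype.card_bool]
    omega
  · simp only [Fintype.sum_bool]
    have := relu_sub_relu_neg (∑ i, w i * hiddenLayer W₁ W v x l i)
    simp only [signOf, if_true, Bool.false_eq_true, if_false]
    rw [one_mul, one_mul, neg_one_mul, neg_one_mul]
    linarith

/-! ### Affine substitution and cutoff, realized by networks -/

/-- Units that vanish on `[δ, 1 - δ]^d` and are not all small outside the unit cube. -/
def penalty {d : ℕ} (δ : ℝ) (y : Fin d → ℝ) : Fin d ⊕ Fin d → ℝ :=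
  Sum.elim (fun j => relu (δ - y j)) (fun j => relu (y j - (1 - δ)))

theorem penalty_nonneg {d : ℕ} (δ : ℝ) (y : Fin d → ℝ) (q : Fin d ⊕ Fin d) :
    0 ≤ penalty δ y q := by
  rcases q with q | q <;> exact relu_nonneg _

/-- The positive (or negative) part of `t`, truncated at `M` and cut off outside the unit cube. -/
def cutoff {d : ℕ} (M P δ t : ℝ) (y : Fin d → ℝ) (a : Bool) : ℝ :=
  relu (relu (signOf a * t) - relu (signOf a * t - M) - P * ∑ q, penalty δ y q)

theorem sum_ite_nz_le {ι : Type} [Fintype ι] [DecidableEq ι] (i : ι) (a : ℝ) :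
    ∑ j, nz (if i = j then a else 0) ≤ 1 := by
  simp only [nz_ite, Finset.sum_ite_eq, Finset.mem_univ, if_true]
  exact nz_le_one a

theorem abs_ite_le {p : Prop} [Decidable p] {a B : ℝ} (hB : 1 ≤ B) (ha : |a| ≤ 1) :
    |if p then a else 0| ≤ B := by
  split_ifs
  · exact ha.trans hB
  · simpa using zero_le_one.trans hB

theorem Hidden.affine {d D : ℕ} {B : ℝ} (hD : 2 * d ≤ D) {A : Matrix (Fin d) (Fin d) ℝ}
    {b : Fin d → ℝ} (hA : ∀ i j, |A i j| ≤ B) (hb : ∀ i, |b i| ≤ B) :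
    Hidden D B 0 (2 * d ^ 2 + 2 * d) (fun (x : Fin d → ℝ) =>
      (Sum.elim (fun j => relu ((A *ᵥ x - b) j)) fun j => relu (-(A *ᵥ x - b) j) :
        Fin d ⊕ Fin d → ℝ)) := by
  refine Hidden.first (Sum.elim (fun i => A i) (fun i j => -A i j)) (Sum.elim b (-b))
    (by simp; omega) ?_ ?_ ?_ ?_
  · rintro (i | i) j
    · exact hA i j
    · simpa using hA i j
  · rintro (i | i)
    · exact hb i
    · simpa using hb i
  · have h1 : affineCost (Sum.elim (fun i => A i) (fun i j => -A i j) : Fin d ⊕ Fin d → Fin d → ℝ)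
        (Sum.elim b (-b)) ≤ ∑ _i : Fin d ⊕ Fin d, ∑ _j : Fin d, 1 + ∑ _i : Fin d ⊕ Fin d, 1 :=
      add_le_add (Finset.sum_le_sum fun _ _ => Finset.sum_le_sum fun _ _ => nz_le_one _)
        (Finset.sum_le_sum fun _ _ => nz_le_one _)
    refine h1.trans (le_of_eq ?_)
    simp; ring
  · rintro x (i | i)
    · rfl
    · simp [Matrix.mulVec, dotProduct, Finset.sum_neg_distrib, neg_add_eq_sub]

/-- The coordinates of `y = A x - b` are stored as positive and negative parts and recombined by the
next layer, so `W₁` is paid for twice and no product of `W₁` with `A`, which could exceed the bound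
`B`, is formed. The `2 d` penalty units start in that layer and are then carried along, costing `2
d` per further layer. -/
theorem Hidden.affine_hiddenLayer {d D D' : ℕ} {B δ : ℝ} (hB : 1 ≤ B) (hδ : 0 ≤ δ) (hδ1 : δ ≤ 1)
    {A : Matrix (Fin d) (Fin d) ℝ} {b : Fin d → ℝ} (hA : ∀ i j, |A i j| ≤ B) (hb : ∀ i, |b i| ≤ B)
    {W₁ : Matrix (Fin D) (Fin d) ℝ} {W : ℕ → Matrix (Fin D) (Fin D) ℝ} {v : ℕ → Fin D → ℝ}
    (hD : D + 2 * d ≤ D') (k : ℕ)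
    (hW₁ : ∀ i j, |W₁ i j| ≤ B) (hW : ∀ l < k, ∀ i j, |W l i j| ≤ B)
    (hv : ∀ l < k + 1, ∀ i, |v l i| ≤ B) :
    Hidden D' B (k + 1) (2 * matNnz W₁ + ∑ l ∈ Finset.range k, matNnz (W l)
        + ∑ l ∈ Finset.range (k + 1), vecNnz (v l) + 2 * d ^ 2 + 8 * d + 2 * d * k)
      (fun x => Sum.elim (hiddenLayer W₁ W v (A *ᵥ x - b) k) (penalty δ (A *ᵥ x - b))) := by
  have hB0 := zero_le_one.trans hB
  induction k with
  | zero =>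
    refine Hidden.next (Hidden.affine (by omega) hA hb)
      (Sum.elim (fun i => Sum.elim (W₁ i) (fun j => -W₁ i j))
        (Sum.elim (fun i => Sum.elim (fun j => if i = j then -1 else 0)
            (fun j => if i = j then 1 else 0))
          (fun i => Sum.elim (fun j => if i = j then 1 else 0)
            (fun j => if i = j then -1 else 0))))
      (Sum.elim (v 0) (Sum.elim (fun _ => -δ) (fun _ => 1 - δ))) (by simp; omega) ?_ ?_ ?_ ?_
    · rintro (i | i | i) (j | j)
      · exact hW₁ i j
      · simpa using hW₁ i j
      all_goals exact abs_ite_le hB (by simp)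
    · rintro (i | i | i)
      · exact hv 0 (by omega) i
      · simp only [Sum.elim_inr, Sum.elim_inl, abs_neg, abs_of_nonneg hδ]; linarith
      · simp only [Sum.elim_inr]
        rw [abs_of_nonneg (by linarith)]; linarith
    · simp only [affineCost, Fintype.sum_sum_type, Sum.elim_inl, Sum.elim_inr, nz_neg]
      rw [Finset.sum_add_distrib, ← matNnz_eq_sum, ← vecNnz_eq_sum]
      have h1 : ∀ a a' : ℝ, ∑ i : Fin d, (∑ j : Fin d, nz (if i = j then a else 0)
          + ∑ j : Fin d, nz (if i = j then a' else 0)) ≤ d * 2 := fun a a' =>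
        (Finset.sum_le_card_nsmul _ _ 2 fun i _ =>
          add_le_add (sum_ite_nz_le i a) (sum_ite_nz_le i a')).trans (by simp)
      have h2 : ∀ a : ℝ, ∑ _i : Fin d, nz a ≤ d := fun a =>
        (Finset.sum_le_card_nsmul _ _ 1 fun i _ => nz_le_one a).trans (by simp)
      have h3 := h1 (-1) 1
      have h4 := h1 1 (-1)
      have h5 := h2 δ
      have h6 := h2 (1 - δ)
      simp only [Finset.range_zero, Finset.sum_empty, zero_add, Finset.range_one,
        Finset.sum_singleton, mul_zero, add_zero]
      omega
    · rintro x (i | i | i)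
      · generalize A *ᵥ x - b = y
        simp only [Sum.elim_inl, hiddenLayer, Fintype.sum_sum_type, Sum.elim_inr, Matrix.mulVec,
          dotProduct]
        rw [← Finset.sum_add_distrib]
        congr 2
        refine Finset.sum_congr rfl fun j _ => ?_
        have := relu_sub_relu_neg (y j)
        linear_combination (-W₁ i j) * this
      · simp only [Sum.elim_inl, Sum.elim_inr, Fintype.sum_sum_type, penalty, ite_mul, zero_mul,
          Finset.sum_ite_eq, Finset.mem_univ, if_true]
        congr 1
        have := relu_sub_relu_neg ((A *ᵥ x - b) i)
        linarith
      · simp only [Sum.elim_inl, Sum.elim_inr, Fintype.sum_sum_type, penalty, ite_mul, zero_mul,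
          Finset.sum_ite_eq, Finset.mem_univ, if_true]
        congr 1
        have := relu_sub_relu_neg ((A *ᵥ x - b) i)
        linarith
  | succ k ih =>
    refine Hidden.next (ih (fun l hl => hW l (by omega)) (fun l hl => hv l (by omega)))
      (Sum.elim (fun i => Sum.elim (W k i) 0)
        (fun q => Sum.elim 0 (fun q' => if q = q' then 1 else 0)))
      (Sum.elim (v (k + 1)) 0) (by simp; omega) ?_ ?_ ?_ ?_
    · rintro (i | i) (j | j)
      · exact hW k (by omega) i j
      · simpa using hB0
      · simpa using hB0
      · exact abs_ite_le hB (by simp)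
    · rintro (i | i)
      · exact hv (k + 1) (by omega) i
      · simpa using hB0
    · simp only [affineCost, Fintype.sum_sum_type (α₁ := Fin D), Sum.elim_inl, Sum.elim_inr,
        Pi.zero_apply, nz_zero, Finset.sum_const_zero, add_zero, zero_add]
      rw [← matNnz_eq_sum, ← vecNnz_eq_sum, Finset.sum_range_succ (fun l => matNnz (W l)) k,
        Finset.sum_range_succ (fun l => vecNnz (v l)) (k + 1)]
      have h1 : ∑ q : Fin d ⊕ Fin d, ∑ q', nz (if q = q' then 1 else 0) ≤ 2 * d :=
        (Finset.sum_le_card_nsmul _ _ 1 fun i _ => sum_ite_nz_le i 1).trans (by simp; omega)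
      have h2 : 2 * d * (k + 1) = 2 * d * k + 2 * d := by ring
      omega
    · rintro x (i | i)
      · simp [hiddenLayer, Matrix.mulVec, dotProduct]
      · simp only [Fintype.sum_sum_type (α₁ := Fin D), Sum.elim_inr, Sum.elim_inl, Pi.zero_apply,
          zero_mul, Finset.sum_const_zero, zero_add, ite_mul, one_mul, Finset.sum_ite_eq,
          Finset.mem_univ, if_true, sub_zero]
        rw [relu_of_nonneg (penalty_nonneg _ _ _)]

/-- The composition of a network with an affine map, truncated and cut off outside the preimage of
the unit cube, is a network. -/
theorem cutoff_mem_network {d L S D L' S' D' : ℕ} {B δ M P c : ℝ} (hB : 1 ≤ B) (hδ : 0 ≤ δ)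
    (hδ1 : δ ≤ 1) (hM : |M| ≤ B) (hP : |P| ≤ B) (hc : |c| ≤ B) (hL : 0 < L) (hLL : L + 3 ≤ L')
    {A : Matrix (Fin d) (Fin d) ℝ} {b : Fin d → ℝ} (hA : ∀ i j, |A i j| ≤ B) (hb : ∀ i, |b i| ≤ B)
    (hD : D + 2 * d + 4 ≤ D')
    (hS : 4 * S + 2 * d ^ 2 + 14 * d + 2 * d * L + 2 * L' + 14 ≤ S')
    {g : (Fin d → ℝ) → ℝ} (hg : g ∈ network d L S D B) :
    (fun x => c * (cutoff M P δ (g (A *ᵥ x - b)) (A *ᵥ x - b) true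
      - cutoff M P δ (g (A *ᵥ x - b)) (A *ᵥ x - b) false)) ∈ network d L' S' D' B := by
  obtain ⟨W₁, W, v, w, h1, h2, h3, h4, h5, rfl⟩ := hg
  have hB0 := zero_le_one.trans hB
  obtain ⟨l, rfl⟩ : ∃ l, L = l + 1 := ⟨L - 1, by omega⟩
  obtain ⟨m, rfl⟩ : ∃ m, L' = l + 1 + 1 + 1 + m + 1 := ⟨L' - l - 4, by omega⟩
  simp only [Nat.add_sub_cancel] at h2 h5 ⊢
  have H := Hidden.affine_hiddenLayer (D' := D') hB hδ hδ1 hA hb (by omega) l h1 h2 h3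
  set g : (Fin d → ℝ) → ℝ := fun y => ∑ i, w i * hiddenLayer W₁ W v y l i with hg
  -- Four units indexed by a sign and by whether `M` is subtracted: their differences are the
  -- truncated positive and negative parts. The output row is copied four times.
  have H2 : Hidden D' B (l + 1 + 1) (4 * S + 2 * d ^ 2 + 10 * d + 2 * d * l + 4)
      (fun x => Sum.elim (fun p : Bool × Bool =>
        relu (signOf p.1 * g (A *ᵥ x - b) - if p.2 then M else 0)) (penalty δ (A *ᵥ x - b))) := by
    refine Hidden.next H (Sum.elim (fun p => Sum.elim (fun i => signOf p.1 * w i) 0)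
        (fun q => Sum.elim 0 (fun q' => if q = q' then 1 else 0)))
      (Sum.elim (fun p => if p.2 then M else 0) 0) (by simp; omega) ?_ ?_ ?_ ?_
    · rintro (i | i) (j | j)
      · simp only [Sum.elim_inl]
        rw [abs_mul, abs_signOf, one_mul]; exact h4 j
      · simpa using hB0
      · simpa using hB0
      · exact abs_ite_le hB (by simp)
    · rintro (i | i)
      · simp only [Sum.elim_inl]
        split_ifs
        · exact hM
        · simpa using hB0
      · simpa using hB0
    · simp only [affineCost, Fintype.sum_sum_type (α₁ := Bool × Bool),
        Fintype.sum_sum_type (α₁ := Fin D), Sum.elim_inl, Sum.elim_inr,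
        Pi.zero_apply, nz_zero, Finset.sum_const_zero, add_zero, zero_add, nz_signOf_mul]
      have e1 : ∑ q : Fin d ⊕ Fin d, ∑ q', nz (if q = q' then 1 else 0) ≤ 2 * d :=
        (Finset.sum_le_card_nsmul _ _ 1 fun i _ => sum_ite_nz_le i 1).trans (by simp; omega)
      have e2 : ∑ p : Bool × Bool, nz (if p.2 = true then M else 0) ≤ 4 :=
        (Finset.sum_le_card_nsmul _ _ 1 fun i _ => nz_le_one _).trans (by simp)
      rw [← vecNnz_eq_sum]
      simp only [Finset.sum_const, Finset.card_univ, Fintype.card_prod, Fintype.card_bool,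
        smul_eq_mul]
      omega
    · rintro x (i | i)
      · simp [Fintype.sum_sum_type, hg, Finset.mul_sum, mul_assoc]
      · simp only [Fintype.sum_sum_type (α₁ := Fin D), Sum.elim_inr, Sum.elim_inl, Pi.zero_apply,
          zero_mul, Finset.sum_const_zero, zero_add, ite_mul, one_mul, Finset.sum_ite_eq,
          Finset.mem_univ, if_true, sub_zero]
        rw [relu_of_nonneg (penalty_nonneg _ _ _)]
  have H3 : Hidden D' B (l + 1 + 1 + 1) (4 * S + 2 * d ^ 2 + 14 * d + 2 * d * l + 12)
      (fun x => cutoff M P δ (g (A *ᵥ x - b)) (A *ᵥ x - b)) := by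
    -- Each of the two units takes the unshifted copy of its own sign, minus the copy shifted by
    -- `M`, minus `P` times every penalty.
    set V : Bool → (Bool × Bool) ⊕ (Fin d ⊕ Fin d) → ℝ := fun a =>
      Sum.elim (fun p => if a = p.1 then (if p.2 then -1 else 1) else 0) (fun _ => -P) with hV
    refine Hidden.next H2 V 0 (by simp; omega) ?_ (fun _ => by simpa using hB0) ?_ ?_
    · rintro a (p | q)
      · exact abs_ite_le hB (by split_ifs <;> simp)
      · simpa [hV] using hP
    · have h6 : affineCost V 0 ≤ ∑ _a : Bool, ∑ _p : (Bool × Bool) ⊕ (Fin d ⊕ Fin d), 1 := by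
        simp only [affineCost, Pi.zero_apply, nz_zero, Finset.sum_const_zero, add_zero]
        exact Finset.sum_le_sum fun _ _ => Finset.sum_le_sum fun _ _ => nz_le_one _
      simp only [Finset.sum_const, Finset.card_univ, Fintype.card_sum, Fintype.card_prod,
        Fintype.card_bool, Fintype.card_fin, smul_eq_mul, mul_one] at h6
      omega
    · intro x a
      simp only [cutoff, hV, Fintype.sum_sum_type (α₁ := Bool × Bool), Sum.elim_inl, Sum.elim_inr,
        Fintype.sum_prod_type, Fintype.sum_bool, Pi.zero_apply, sub_zero]
      rw [← Finset.mul_sum]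
      congr 1
      cases a <;> simp <;> ring
  have H4 := H3.carry hB (by simp; omega) (fun x a => relu_nonneg _) m
  refine H4.mem_network hB0 (fun a => signOf a * c)
    (fun a => by rw [abs_mul, abs_signOf, one_mul]; exact hc) ?_ fun x => ?_
  · have : ∑ a, nz (signOf a * c) ≤ 2 :=
      (Finset.sum_le_card_nsmul _ _ 1 fun a _ => nz_le_one _).trans (by simp)
    simp only [Fintype.card_bool]
    have e2 : 2 * d * (l + 1) = 2 * d * l + 2 * d := by ring
    omega
  · simp [signOf, hg]; ring

/-! ### Approximation error of the cutoff -/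

theorem relu_sub_relu_sub {M : ℝ} (hM : 0 ≤ M) (t : ℝ) :
    relu t - relu (t - M) = max 0 (min t M) := by
  rcases le_total t M with h | h
  · rw [min_eq_left h, relu_of_nonpos (by linarith : t - M ≤ 0), sub_zero, relu, max_comm]
  · rw [min_eq_right h, max_eq_right hM, relu_of_nonneg (by linarith : 0 ≤ t - M),
      relu_of_nonneg (hM.trans h)]
    ring

theorem cutoff_nonneg {d : ℕ} (M P δ t : ℝ) (y : Fin d → ℝ) (a : Bool) : 0 ≤ cutoff M P δ t y a :=
  relu_nonneg _

theorem cutoff_le {d : ℕ} {M P : ℝ} (hM : 0 ≤ M) (hP : 0 ≤ P) (δ t : ℝ) (y : Fin d → ℝ)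
    (a : Bool) : cutoff M P δ t y a ≤ M := by
  rw [cutoff, relu_sub_relu_sub hM]
  have h1 : 0 ≤ P * ∑ q, penalty δ y q :=
    mul_nonneg hP (Finset.sum_nonneg fun q _ => penalty_nonneg δ y q)
  have h2 : max 0 (min (signOf a * t) M) ≤ M := max_le hM (min_le_right _ _)
  exact max_le (by linarith) hM

/-- Outside the cube some penalty unit is at least `δ`, so slope `M / δ` removes at least `M`, the
most that truncation lets through. Without truncation no fixed slope would suffice, because `t` is
arbitrary there. -/
theorem cutoff_eq_zero {d : ℕ} {M δ : ℝ} (hM : 0 ≤ M) (hδ : 0 < δ) (t : ℝ) {y : Fin d → ℝ}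
    (hy : y ∉ cube d) (a : Bool) : cutoff M (M / δ) δ t y a = 0 := by
  rw [cutoff, relu_sub_relu_sub hM]
  refine relu_of_nonpos ?_
  have h1 : δ ≤ ∑ q, penalty δ y q := by
    have h2 : ∃ q, δ ≤ penalty δ y q := by
      by_contra! hcon
      refine hy ⟨fun j => ?_, fun j => ?_⟩
      · have := (le_max_left _ _).trans_lt (hcon (Sum.inl j))
        simp only [Pi.zero_apply]; linarith
      · have := (le_max_left _ _).trans_lt (hcon (Sum.inr j))
        simp only [Pi.one_apply]; linarith
    obtain ⟨q, hq⟩ := h2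
    exact hq.trans (Finset.single_le_sum (fun q _ => penalty_nonneg δ y q) (Finset.mem_univ q))
  have h2 : M ≤ M / δ * ∑ q, penalty δ y q := by
    calc M = M / δ * δ := by field_simp
      _ ≤ _ := mul_le_mul_of_nonneg_left h1 (by positivity)
  have h3 : max 0 (min (signOf a * t) M) ≤ M := max_le hM (min_le_right _ _)
  linarith

/-- The penalties vanish here, so the difference of the two parts is `t` clipped to `[-M, M]`;
clipping cannot move `t` away from a point `u` of that interval. -/
theorem abs_cutoff_sub_le {d : ℕ} {M P δ t u : ℝ} (hM : 0 ≤ M) (hu : |u| ≤ M) {y : Fin d → ℝ}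
    (hy : y ∈ Set.Icc (fun _ => δ) (fun _ : Fin d => 1 - δ)) :
    |cutoff M P δ t y true - cutoff M P δ t y false - u| ≤ |t - u| := by
  have h0 : ∑ q, penalty δ y q = 0 := by
    refine Finset.sum_eq_zero fun q _ => ?_
    rcases q with j | j
    · exact relu_of_nonpos (by linarith [hy.1 j])
    · exact relu_of_nonpos (by linarith [hy.2 j])
  simp only [cutoff, relu_sub_relu_sub hM, h0, mul_zero, sub_zero, signOf, if_true,
    Bool.false_eq_true, if_false, one_mul, neg_one_mul]
  rw [relu_of_nonneg (le_max_left _ _), relu_of_nonneg (le_max_left _ _)]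
  have hu' := abs_le.mp hu
  have h1 := neg_abs_le (t - u)
  have h2 := le_abs_self (t - u)
  rw [abs_le]
  rcases le_total 0 t with ht | ht
  · rw [max_eq_left (min_le_of_left_le (by linarith : -t ≤ 0)), max_eq_right (le_min ht hM)]
    rcases le_total t M with h | h
    · rw [min_eq_left h]; constructor <;> linarith
    · rw [min_eq_right h]; constructor <;> linarith
  · rw [max_eq_left (min_le_of_left_le ht), max_eq_right (le_min (by linarith : 0 ≤ -t) hM)]
    rcases le_total (-t) M with h | h
    · rw [min_eq_left h]; constructor <;> linarith
    · rw [min_eq_right h]; constructor <;> linarith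

theorem volume_cube_diff_le {d : ℕ} {δ : ℝ} (hδ : 0 ≤ δ) (hδ2 : 2 * δ ≤ 1) :
    volume (cube d \ Set.Icc (fun _ => δ) (fun _ => 1 - δ)) ≤ ENNReal.ofReal (2 * d * δ) := by
  have hsub : Set.Icc (fun _ => δ) (fun _ : Fin d => 1 - δ) ⊆ cube d := fun y hy =>
    ⟨fun j => hδ.trans (hy.1 j), fun j => (hy.2 j).trans (by simpa using hδ)⟩
  rw [measure_sdiff hsub measurableSet_Icc.nullMeasurableSet
    (by rw [Real.volume_Icc_pi]; exact ENNReal.prod_ne_top fun _ _ => ENNReal.ofReal_ne_top)]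
  rw [cube, Real.volume_Icc_pi, Real.volume_Icc_pi]
  simp only [Pi.one_apply, Pi.zero_apply, sub_zero, ENNReal.ofReal_one, Finset.prod_const_one,
    Finset.prod_const, Finset.card_univ, Fintype.card_fin]
  rw [← ENNReal.ofReal_pow (by linarith), ← ENNReal.ofReal_one,
    ← ENNReal.ofReal_sub _ (pow_nonneg (by linarith) _)]
  apply ENNReal.ofReal_le_ofReal
  -- Bernoulli's inequality: `(1 - 2 δ)^d ≥ 1 - 2 d δ`.
  have := one_add_mul_le_pow (a := -(2 * δ)) (by linarith) d
  rw [show 1 - δ - δ = 1 + -(2 * δ) by ring]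
  linarith

/-- Three regions: on the inner cube the error is at most that of `g`, outside the cube it is zero,
and on the strip of volume at most `2 d δ` it is at most `2 M`. The integral runs over all of `ℝ^d`,
which makes it ready for a change of variables. -/
theorem lintegral_cutoff_sub_le {d : ℕ} {M δ ε : ℝ} (hM : 0 ≤ M) (hδ : 0 < δ) (hδ2 : 2 * δ ≤ 1)
    (hε : 0 ≤ ε) {φ g : (Fin d → ℝ) → ℝ} (hφ : ∀ᵐ x ∂(cubeMeasure d), |φ x| ≤ M)
    (hg : eLpNorm (g - φ) 2 (cubeMeasure d) ≤ ENNReal.ofReal ε) :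
    ∫⁻ y, ENNReal.ofReal ((cutoff M (M / δ) δ (g y) y true - cutoff M (M / δ) δ (g y) y false
      - (cube d).indicator φ y) ^ 2) ≤ ENNReal.ofReal (ε ^ 2 + 8 * M ^ 2 * d * δ) := by
  set K := Set.Icc (fun _ => δ) (fun _ : Fin d => 1 - δ) with hK
  have hcm : MeasurableSet (cube d) := measurableSet_Icc
  have hKm : MeasurableSet K := measurableSet_Icc
  have hφ' : ∀ᵐ x, x ∈ cube d → |φ x| ≤ M := (ae_restrict_iff' hcm).mp hφ
  have hP : 0 ≤ M / δ := by positivity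
  calc _ ≤ ∫⁻ y, ((cube d).indicator (fun y => ENNReal.ofReal ((g - φ) y ^ 2)) y +
        (cube d \ K).indicator (fun _ => ENNReal.ofReal (4 * M ^ 2)) y) := by
        refine lintegral_mono_ae ?_
        filter_upwards [hφ'] with y hy
        by_cases hyc : y ∈ cube d
        · by_cases hyK : y ∈ K
          · rw [Set.indicator_of_mem hyc, Set.indicator_of_mem hyc]
            refine le_trans (ENNReal.ofReal_le_ofReal ?_) le_self_add
            exact sq_le_sq.mpr (abs_cutoff_sub_le hM (hy hyc) hyK)
          · rw [Set.indicator_of_mem hyc, Set.indicator_of_mem (Set.mem_sdiff_of_mem hyc hyK)]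
            refine le_trans (ENNReal.ofReal_le_ofReal ?_) le_add_self
            have h1 := cutoff_le hM hP δ (g y) y
            have h2 := cutoff_nonneg M (M / δ) δ (g y) y
            have h3 := abs_le.mp (hy hyc)
            rw [show 4 * M ^ 2 = (2 * M) ^ 2 by ring]
            refine sq_le_sq' ?_ ?_ <;> linarith [h1 true, h1 false, h2 true, h2 false]
        · simp [hyc, cutoff_eq_zero hM hδ]
    _ = ∫⁻ y, ENNReal.ofReal ((g - φ) y ^ 2) ∂(cubeMeasure d)
        + ENNReal.ofReal (4 * M ^ 2) * volume (cube d \ K) := by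
        rw [lintegral_add_right _ (measurable_const.indicator (hcm.diff hKm)),
          lintegral_indicator hcm, lintegral_indicator_const (hcm.diff hKm)]
        rfl
    _ ≤ ENNReal.ofReal (ε ^ 2) + ENNReal.ofReal (4 * M ^ 2) * ENNReal.ofReal (2 * d * δ) := by
        gcongr
        · rw [← eLpNorm_two_sq, ENNReal.ofReal_pow hε]
          gcongr
        · exact volume_cube_diff_le hδ.le hδ2
    _ = ENNReal.ofReal (ε ^ 2 + 8 * M ^ 2 * d * δ) := by
        rw [← ENNReal.ofReal_mul (by positivity), ← ENNReal.ofReal_add (by positivity)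
          (by positivity)]
        congr 1; ring

/-! ### Sums of affinely transformed functions, and clipping -/

section Affine

variable {d : ℕ} {A : Matrix (Fin d) (Fin d) ℝ} (hA : A.det ≠ 0) (b : Fin d → ℝ)

include hA

/-- Preimages of null sets under an invertible affine map are null, so almost everywhere properties
of `φ` survive the substitution. -/
theorem quasiMeasurePreserving_affine :
    Measure.QuasiMeasurePreserving (fun x : Fin d → ℝ => A *ᵥ x - b) volume volume := by
  have h1 : Measure.QuasiMeasurePreserving (Matrix.toLin' A) volume volume :=
    Measure.LinearMap.quasiMeasurePreserving volume _ (by rwa [LinearMap.det_toLin'])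
  exact (measurePreserving_sub_right volume b).quasiMeasurePreserving.comp h1

theorem lintegral_comp_affine (Q : (Fin d → ℝ) → ℝ≥0∞) (hQ : AEMeasurable Q) :
    ∫⁻ x, Q (A *ᵥ x - b) = ENNReal.ofReal |A.det|⁻¹ * ∫⁻ y, Q y := by
  have hm := Real.map_matrix_volume_pi_eq_smul_volume_pi hA
  have h1 : ∫⁻ y, Q (y - b) ∂(Measure.map (Matrix.toLin' A) volume) = ∫⁻ x, Q (A *ᵥ x - b) := by
    rw [lintegral_map' _ (Matrix.toLin' A).continuous_of_finiteDimensional.aemeasurable]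
    · simp
    · rw [hm]
      exact (hQ.comp_quasiMeasurePreserving
        (measurePreserving_sub_right volume b).quasiMeasurePreserving).smul_measure _
  rw [← h1, hm, lintegral_smul_measure, lintegral_sub_right_eq_self, abs_inv, smul_eq_mul]

end Affine

theorem clip_eq {F : ℝ} (hF : 0 ≤ F) (t : ℝ) :
    Real.sign t * min |t| F = max (-F) (min t F) := by
  rcases lt_trichotomy t 0 with h | h | h
  · rw [Real.sign_of_neg h, abs_of_neg h, min_eq_left (h.le.trans hF), neg_one_mul, ← max_neg_neg,
      neg_neg, max_comm]
  · simp [h, hF]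
  · rw [Real.sign_of_pos h, abs_of_pos h, one_mul, max_eq_right]
    exact le_min (by linarith) (by linarith)

theorem abs_clip_le {F : ℝ} (hF : 0 ≤ F) (t : ℝ) : |max (-F) (min t F)| ≤ F :=
  abs_le.mpr ⟨le_max_left _ _, max_le (by linarith) (min_le_right _ _)⟩

theorem abs_clip_sub_le (F t u : ℝ) :
    |max (-F) (min t F) - max (-F) (min u F)| ≤ |t - u| :=
  (abs_max_sub_max_le_max _ _ _ _).trans (max_le (by simp)
    ((abs_min_sub_min_le_max _ _ _ _).trans (max_le le_rfl (by simp))))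

theorem clip_of_abs_le {F t : ℝ} (h : |t| ≤ F) : max (-F) (min t F) = t := by
  rw [min_eq_left (abs_le.mp h).2, max_eq_right (abs_le.mp h).1]

theorem ae_abs_le_of_iSup_eLpNorm {d : ℕ} {Φ : Set ((Fin d → ℝ) → ℝ)}
    (hbdd : (⨆ φ ∈ Φ, eLpNorm φ ⊤ (cubeMeasure d)) < ⊤) {φ : (Fin d → ℝ) → ℝ} (hφ : φ ∈ Φ) :
    ∀ᵐ x ∂(cubeMeasure d), |φ x| ≤ (⨆ φ ∈ Φ, eLpNorm φ ⊤ (cubeMeasure d)).toReal := by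
  have h1 : eLpNorm φ ⊤ (cubeMeasure d) ≤ ⨆ φ ∈ Φ, eLpNorm φ ⊤ (cubeMeasure d) :=
    le_iSup₂ (f := fun φ (_ : φ ∈ Φ) => eLpNorm φ ⊤ (cubeMeasure d)) φ hφ
  rw [eLpNorm_exponent_top] at h1
  filter_upwards [ae_le_eLpNormEssSup (f := φ) (μ := cubeMeasure d)] with x hx
  have h2 := ENNReal.toReal_mono hbdd.ne (hx.trans h1)
  rwa [toReal_enorm] at h2

/-- Approximation of a member of the affine class by sums of cut off functions. -/
theorem lintegral_sum_cutoff_sub_le {d ns : ℕ} {M δ ε C : ℝ} (hM : 0 ≤ M) (hδ : 0 < δ)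
    (hδ2 : 2 * δ ≤ 1) (hε : 0 ≤ ε) {c : Fin ns → ℝ} {φ g : Fin ns → (Fin d → ℝ) → ℝ}
    {A : Fin ns → Matrix (Fin d) (Fin d) ℝ} {b : Fin ns → Fin d → ℝ}
    (hφm : ∀ i, AEStronglyMeasurable (φ i) (cubeMeasure d))
    (hφ : ∀ i, ∀ᵐ x ∂(cubeMeasure d), |φ i x| ≤ M) (hgm : ∀ i, Measurable (g i))
    (hg : ∀ i, eLpNorm (g i - φ i) 2 (cubeMeasure d) ≤ ENNReal.ofReal ε)
    (hA : ∀ i, (A i).det ≠ 0) (hAC : ∀ i, |(A i).det|⁻¹ ≤ C) (hc : ∀ i, |c i| ≤ C) :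
    ∫⁻ x, ENNReal.ofReal ((∑ i, c i * (cutoff M (M / δ) δ (g i (A i *ᵥ x - b i))
        (A i *ᵥ x - b i) true - cutoff M (M / δ) δ (g i (A i *ᵥ x - b i)) (A i *ᵥ x - b i) false)
      - ∑ i, c i * (cube d).indicator (φ i) (A i *ᵥ x - b i)) ^ 2) ∂(cubeMeasure d)
      ≤ ENNReal.ofReal (ns ^ 2 * C ^ 3 * (ε ^ 2 + 8 * M ^ 2 * d * δ)) := by
  set ψ : Fin ns → (Fin d → ℝ) → ℝ := fun i y =>
    cutoff M (M / δ) δ (g i y) y true - cutoff M (M / δ) δ (g i y) y false with hψ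
  have hcutm : ∀ i a, Measurable fun y => cutoff M (M / δ) δ (g i y) y a := by
    intro i a
    have hr : Measurable relu := continuous_relu.measurable
    have hp : ∀ q, Measurable fun y : Fin d → ℝ => penalty δ y q := by
      rintro (j | j)
      · exact hr.comp (measurable_const.sub (measurable_pi_apply j))
      · exact hr.comp ((measurable_pi_apply j).sub measurable_const)
    unfold cutoff
    have := hgm i
    fun_prop
  set Q : Fin ns → (Fin d → ℝ) → ℝ≥0∞ := fun i y =>
    ENNReal.ofReal ((ψ i y - (cube d).indicator (φ i) y) ^ 2) with hQ
  have hQm : ∀ i, AEMeasurable (Q i) := fun i => by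
    have h1 : AEMeasurable ((cube d).indicator (φ i)) :=
      (aemeasurable_indicator_iff measurableSet_Icc).mpr (hφm i).aemeasurable
    exact ((((hcutm i true).sub (hcutm i false)).aemeasurable.sub h1).pow_const 2).ennreal_ofReal
  rcases Nat.eq_zero_or_pos ns with rfl | hns
  · simp
  have hC : 0 ≤ C := (abs_nonneg _).trans (hc ⟨0, hns⟩)
  have hb0 : 0 ≤ ε ^ 2 + 8 * M ^ 2 * d * δ := by positivity
  calc _ ≤ ∫⁻ x, ENNReal.ofReal (ns * C ^ 2) * ∑ i, Q i (A i *ᵥ x - b i) := by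
        -- Cauchy–Schwarz over the `ns` summands, then enlarging the domain from the cube to the
        -- whole space. Two factors of `C` come from the coefficients, the third from the Jacobian.
        refine (lintegral_mono fun x => ?_).trans
          (setLIntegral_le_lintegral (cube d) _)
        rw [← ENNReal.ofReal_sum_of_nonneg fun i _ => sq_nonneg _,
          ← ENNReal.ofReal_mul (by positivity)]
        apply ENNReal.ofReal_le_ofReal
        rw [← Finset.sum_sub_distrib, mul_assoc, Finset.mul_sum]
        refine sq_sum_le_card_mul_sum_sq.trans ?_
        rw [Finset.card_univ, Fintype.card_fin]
        refine mul_le_mul_of_nonneg_left (Finset.sum_le_sum fun i _ => ?_) (Nat.cast_nonneg _)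
        rw [← mul_sub, mul_pow]
        refine mul_le_mul_of_nonneg_right ?_ (sq_nonneg _)
        exact sq_le_sq' (abs_le.mp (hc i)).1 (abs_le.mp (hc i)).2
    _ = ENNReal.ofReal (ns * C ^ 2) * ∑ i, ENNReal.ofReal |(A i).det|⁻¹ * ∫⁻ y, Q i y := by
        have hm : ∀ i, AEMeasurable fun x => Q i (A i *ᵥ x - b i) := fun i =>
          (hQm i).comp_quasiMeasurePreserving (quasiMeasurePreserving_affine (hA i) (b i))
        rw [lintegral_const_mul' _ _ ENNReal.ofReal_ne_top, lintegral_finsetSum' _ fun i _ => hm i]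
        simp_rw [fun i => lintegral_comp_affine (hA i) (b i) (Q i) (hQm i)]
    _ ≤ ENNReal.ofReal (ns * C ^ 2) *
        ∑ _i : Fin ns, ENNReal.ofReal C * ENNReal.ofReal (ε ^ 2 + 8 * M ^ 2 * d * δ) := by
        gcongr with i
        · exact hAC i
        · exact lintegral_cutoff_sub_le hM hδ hδ2 hε (hφ i) (hg i)
    _ = _ := by
        rw [Finset.sum_const, Finset.card_univ, Fintype.card_fin, nsmul_eq_mul,
          ← ENNReal.ofReal_natCast ns, ← ENNReal.ofReal_mul hC,
          ← ENNReal.ofReal_mul (Nat.cast_nonneg ns), ← ENNReal.ofReal_mul (by positivity)]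
        congr 1; ring

theorem aemeasurable_affine_sum {d ns : ℕ} {c : Fin ns → ℝ} {φ : Fin ns → (Fin d → ℝ) → ℝ}
    {A : Fin ns → Matrix (Fin d) (Fin d) ℝ} {b : Fin ns → Fin d → ℝ}
    (hφm : ∀ i, AEStronglyMeasurable (φ i) (cubeMeasure d)) (hA : ∀ i, (A i).det ≠ 0) :
    AEMeasurable (fun x => ∑ i, c i * (cube d).indicator (φ i) (A i *ᵥ x - b i))
      (cubeMeasure d) := by
  refine Finset.aemeasurable_fun_sum _ fun i _ => AEMeasurable.const_mul ?_ _
  have h1 : AEMeasurable ((cube d).indicator (φ i)) :=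
    (aemeasurable_indicator_iff measurableSet_Icc).mpr (hφm i).aemeasurable
  exact (h1.comp_quasiMeasurePreserving
    (quasiMeasurePreserving_affine (hA i) (b i))).restrict

theorem ae_abs_affine_sum_le {d ns : ℕ} {M C : ℝ} (hM : 0 ≤ M) {c : Fin ns → ℝ}
    {φ : Fin ns → (Fin d → ℝ) → ℝ}
    {A : Fin ns → Matrix (Fin d) (Fin d) ℝ} {b : Fin ns → Fin d → ℝ}
    (hφ : ∀ i, ∀ᵐ x ∂(cubeMeasure d), |φ i x| ≤ M) (hA : ∀ i, (A i).det ≠ 0)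
    (hc : ∀ i, |c i| ≤ C) :
    ∀ᵐ x ∂(cubeMeasure d),
      |∑ i, c i * (cube d).indicator (φ i) (A i *ᵥ x - b i)| ≤ ns * C * M := by
  have h1 : ∀ᵐ x ∂(cubeMeasure d), ∀ i, |(cube d).indicator (φ i) (A i *ᵥ x - b i)| ≤ M := by
    refine ae_all_iff.mpr fun i => ae_restrict_of_ae ?_
    refine (quasiMeasurePreserving_affine (hA i) (b i)).ae
      (p := fun y => |(cube d).indicator (φ i) y| ≤ M) ?_
    filter_upwards [(ae_restrict_iff' measurableSet_Icc).mp (hφ i)] with y hy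
    by_cases h : y ∈ cube d
    · rw [Set.indicator_of_mem h]; exact hy h
    · rw [Set.indicator_of_notMem h]; simpa using hM
  filter_upwards [h1] with x hx
  have := abs_sum_mul_le hc hx
  rwa [← mul_assoc] at this

/-! ### Metric entropy and the risk bound -/

/-- The metric entropy of sparse networks at scale `1 / n`. -/
theorem log_card_sparseCode_le {d L S D n : ℕ} {B : ℝ} (hL : 0 < L) (hD : 0 < D) (hd : d ≤ D)
    (hB : 1 ≤ B) (hn : 0 < n) (hnB : (n : ℝ) ≤ B) :
    Real.log (Fintype.card (SparseCode (ParamIdx d L D) S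
      ⌊B / (1 / (n * ((L + 1) * (B * (D + 1)) ^ (L + 1))))⌋₊))
      ≤ S * ((3 * L + 12) * Real.log (B * (D + 1))) := by
  have hLR : (1 : ℝ) ≤ L := by exact_mod_cast hL
  have hDR : (1 : ℝ) ≤ D := by exact_mod_cast hD
  have hnR : (1 : ℝ) ≤ n := by exact_mod_cast hn
  have hdR : (d : ℝ) ≤ D := by exact_mod_cast hd
  -- Every quantity in the cardinality is bounded by a power of `E`: since `E ≥ 2`, numerical
  -- constants and `L + 1` are absorbed too, and `n ≤ B` absorbs the sample size.
  set E := B * (D + 1) with hE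
  have hE2 : 2 ≤ E := by nlinarith
  have hDE : (D : ℝ) ≤ E := by nlinarith
  have hBE : B ≤ E := by nlinarith
  have hnE : (n : ℝ) ≤ E := hnB.trans hBE
  have hE0 : 0 ≤ E := by linarith
  have hE1 : 1 ≤ E := by linarith
  have hpow : (L : ℝ) + 1 ≤ E ^ (L + 1) := by
    have h1 : ((L + 1 : ℕ) : ℝ) ≤ (2 : ℝ) ^ (L + 1) := by
      exact_mod_cast (Nat.lt_two_pow_self (n := L + 1)).le
    push_cast at h1
    exact h1.trans (pow_le_pow_left₀ (by norm_num) hE2 _)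
  set G := ⌊B / (1 / (n * ((L + 1) * E ^ (L + 1))))⌋₊ with hG
  have hGle : (G : ℝ) ≤ E ^ (2 * L + 4) := by
    have h1 : (G : ℝ) ≤ B / (1 / (n * ((L + 1) * E ^ (L + 1)))) := Nat.floor_le (by positivity)
    refine h1.trans ?_
    rw [div_div_eq_mul_div, div_one]
    calc B * (n * ((L + 1) * E ^ (L + 1))) ≤ E * (E * (E ^ (L + 1) * E ^ (L + 1))) := by gcongr
      _ = E ^ (2 * L + 4) := by ring
  have hI : ((D * d + ((L - 1) * (D * D) + (L * D + D)) : ℕ) : ℝ) ≤ E ^ (L + 5) := by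
    rw [Nat.cast_add, Nat.cast_add, Nat.cast_mul, Nat.cast_mul, Nat.cast_mul, Nat.cast_sub hL]
    push_cast
    have hDD : (D : ℝ) ≤ D * D := by nlinarith
    have hLD : (L : ℝ) * D ≤ L * (D * D) := by gcongr
    have hDd : (D : ℝ) * d ≤ D * D := by gcongr
    have hDD' : (D : ℝ) * D ≤ E * E := by gcongr
    have h4 : (4 : ℝ) ≤ E * E := by nlinarith
    have h5 : (D : ℝ) * D ≤ L * (D * D) := le_mul_of_one_le_left (by positivity) hLR
    calc (D : ℝ) * d + ((L - 1) * (D * D) + (L * D + D)) ≤ 4 * ((L + 1) * (D * D)) := by nlinarith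
      _ ≤ (E * E) * (E ^ (L + 1) * (E * E)) := by gcongr
      _ = E ^ (L + 5) := by ring
  have h2G : (2 * G + 1 : ℝ) ≤ E ^ (2 * L + 6) := by
    have h1 : 1 ≤ E ^ (2 * L + 4) := one_le_pow₀ hE1
    have h4 : 4 * E ^ (2 * L + 4) ≤ E * E * E ^ (2 * L + 4) := by gcongr; nlinarith
    calc (2 * G + 1 : ℝ) ≤ 4 * E ^ (2 * L + 4) := by linarith
      _ ≤ E * E * E ^ (2 * L + 4) := h4
      _ = E ^ (2 * L + 6) := by ring
  have hbase : (((D * d + ((L - 1) * (D * D) + (L * D + D))) * (2 * G + 1) + 1 : ℕ) : ℝ)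
      ≤ E ^ (3 * L + 12) := by
    rw [Nat.cast_add, Nat.cast_mul]
    push_cast at hI ⊢
    have h1 : 1 ≤ E ^ (3 * L + 11) := one_le_pow₀ hE1
    have h2 := mul_le_mul hI h2G (by positivity) (by positivity)
    have e : E ^ (L + 5) * E ^ (2 * L + 6) = E ^ (3 * L + 11) := by ring
    rw [e] at h2
    have h3 : E ^ (3 * L + 12) = E * E ^ (3 * L + 11) := by ring
    rw [h3]
    nlinarith
  rw [card_sparseCode, Nat.cast_pow, Real.log_pow]
  refine mul_le_mul_of_nonneg_left ?_ (Nat.cast_nonneg S)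
  refine (Real.log_le_log (by positivity) hbase).trans (le_of_eq ?_)
  rw [Real.log_pow]
  push_cast
  ring

/-- Risk bound for empirical risk minimizers over clipped sparse networks. -/
theorem risk_le_of_isERM_clippedNetwork {d n L S D : ℕ} {B σ F lam : ℝ} (hn : 0 < n) (hL : 0 < L)
    (hD : 0 < D) (hd : d ≤ D) (hB : 1 ≤ B) (hnB : (n : ℝ) ≤ B) (hF : 0 ≤ F) (hl : 0 < lam)
    (hlσ : 4 * lam * σ ^ 2 ≤ 1) (hlF : lam * (2 * F) ^ 2 ≤ 2)
    {f₁ : (Fin d → ℝ) → ℝ} (hfm : Measurable f₁) (hfF : ∀ x, |f₁ x| ≤ F)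
    {fs : (Fin d → ℝ) → ℝ} (hs : fs ∈ network d L S D B)
    {fhat : Sample d n → (Fin d → ℝ) → ℝ} (hE : IsERM (clippedNetwork d F L S D B) fhat) :
    risk σ fhat f₁ ≤ ENNReal.ofReal (2 * (1 / n) ^ 2 +
      8 * ((S * ((3 * L + 12) * Real.log (B * (D + 1))) + 1) / (lam * n)
      + (1 / n) * (4 * F + 1 + σ ^ 2) + ∫ x, (fs x - f₁ x) ^ 2 ∂(cubeMeasure d))) := by
  have hnR : (0 : ℝ) < n := by exact_mod_cast hn
  have hclip : clippedNetwork d F L S D B =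
      (fun f x => max (-F) (min (f x) F)) '' network d L S D B := by
    unfold clippedNetwork
    congr 1
    funext f x
    exact clip_eq hF _
  have hE0 : 0 < B * ((D : ℝ) + 1) := by positivity
  -- The mesh for which the Lipschitz bound gives a uniform error of exactly `1 / n`.
  set η : ℝ := 1 / (n * ((L + 1) * (B * (D + 1)) ^ (L + 1))) with hη
  have hη0 : 0 < η := by positivity
  have hηe : (L + 1) * (η * (B * (D + 1)) ^ (L + 1)) = 1 / n := by
    rw [hη]; field_simp
  have hsm : Measurable fs := (continuous_of_mem_network hs).measurable
  have key := risk_le_of_net (σ := σ) (δ := 1 / n) hn hl hlσ hlF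
    (T := SparseCode (ParamIdx d L D) S ⌊B / η⌋₊)
    (fun c x => max (-F) (min (realize (c.decode η) x) F))
    (fun c => measurable_const.max ((continuous_realize _).measurable.min measurable_const))
    (fun c x => abs_clip_le hF _) (clippedNetwork d F L S D B)
    (by rw [hclip]; rintro _ ⟨f, -, rfl⟩ x; exact abs_clip_le hF _)
    (by
      rw [hclip]; rintro _ ⟨f, hf, rfl⟩
      obtain ⟨c, hc⟩ := exists_net_network hL hd hB hη0 hf
      rw [hηe] at hc
      exact ⟨c, fun x hx => (abs_clip_sub_le F _ _).trans (hc x hx)⟩)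
    hfm hfF (fs := fun x => max (-F) (min (fs x) F))
    (measurable_const.max (hsm.min measurable_const))
    (by rw [hclip]; exact ⟨fs, hs, rfl⟩) hE
  refine key.trans (ENNReal.ofReal_le_ofReal ?_)
  have h1 := log_card_sparseCode_le (S := S) hL hD hd hB hn hnB
  -- Clipping the comparison network cannot hurt, because `f₁` takes values in `[-F, F]`.
  have h2 : ∫ x, (max (-F) (min (fs x) F) - f₁ x) ^ 2 ∂(cubeMeasure d)
      ≤ ∫ x, (fs x - f₁ x) ^ 2 ∂(cubeMeasure d) := by
    have hcont := continuous_of_mem_network hs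
    have hbd : ∃ R, ∀ x ∈ cube d, |fs x| ≤ R := by
      obtain ⟨R, hR⟩ := (isCompact_Icc (a := (0 : Fin d → ℝ)) (b := 1)).exists_bound_of_continuousOn
        hcont.continuousOn
      exact ⟨R, hR⟩
    obtain ⟨R, hR⟩ := hbd
    have hpt : ∀ x, (max (-F) (min (fs x) F) - f₁ x) ^ 2 ≤ (fs x - f₁ x) ^ 2 := fun x => by
      have := abs_clip_sub_le F (fs x) (f₁ x)
      rw [clip_of_abs_le (hfF x)] at this
      exact sq_le_sq.mpr this
    have hint : Integrable (fun x => (fs x - f₁ x) ^ 2) (cubeMeasure d) := by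
      refine Integrable.of_bound ((hsm.sub hfm).pow_const 2).aestronglyMeasurable ((R + F) ^ 2) ?_
      filter_upwards [ae_mem_cube d] with x hx
      rw [Real.norm_of_nonneg (sq_nonneg _)]
      have h3 := abs_le.mp (hR x hx)
      have h4 := abs_le.mp (hfF x)
      exact sq_le_sq' (by linarith) (by linarith)
    exact integral_mono_of_nonneg (Filter.Eventually.of_forall fun x => sq_nonneg _) hint
      (Filter.Eventually.of_forall hpt)
  gcongr

/-- The approximation property with parameters that do not depend on the function. -/
theorem exists_network_of_AP {d : ℕ} {C₁ C₂ : ℝ} {φ : (Fin d → ℝ) → ℝ} (hφ : φ ∈ AP d C₁ C₂)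
    {n : ℕ} (hn : 2 ≤ n) {B : ℝ} (hB : C₂ * (n + 1) ≤ B) :
    ∃ (L S D : ℕ) (g : (Fin d → ℝ) → ℝ), 0 < L ∧ L ≤ ⌊C₁ * Real.log (n + 1)⌋₊ ∧
      S ≤ ⌊C₁ * Real.log (n + 1)⌋₊ ∧ D ≤ ⌊C₁ * Real.log (n + 1)⌋₊ ∧ g ∈ network d L S D B ∧
      eLpNorm (g - φ) 2 (cubeMeasure d) ≤ ENNReal.ofReal (1 / (n + 1)) := by
  have hnR : (2 : ℝ) ≤ n := by exact_mod_cast hn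
  -- Accuracy `1 / (n + 1)` instead of `1 / n`: approximability is only given for accuracies
  -- strictly below `1/2`, which excludes `1 / n` at `n = 2`.
  obtain ⟨L, S, D, B₀, ⟨hL, -⟩, h1, h2, h3, h4, g, hg, hgφ⟩ := hφ.2 (1 / (n + 1)) (by positivity)
    (one_div_lt_one_div_of_lt (by norm_num) (by linarith))
  simp only [div_div_eq_mul_div, div_one, one_mul] at h1 h2 h3 h4
  exact ⟨L, S, D, g, hL, Nat.le_floor h1, Nat.le_floor h2, Nat.le_floor h3,
    network_mono le_rfl (h4.trans hB) hg, hgφ⟩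

/-- Risk bound for empirical risk minimizers over clipped sparse networks, when the regression
function is a sum of affine transformations of functions approximated by networks. -/
theorem risk_le_of_affine_sum {d n ns m L S D : ℕ} {B σ F lam M C ε : ℝ} (hn : 2 ≤ n)
    (hns : 0 < ns) (hL : m + 3 ≤ L) (hD : m + 2 * d + 4 ≤ D)
    (hS : 4 * m + 2 * d ^ 2 + 14 * d + 2 * d * m + 2 * L + 14 ≤ S)
    (hnB : (n : ℝ) ≤ B) (hMB : M * n ≤ B) (hCB : C ≤ B) (hM : 0 ≤ M) (hC : 0 ≤ C)
    (hF : ns * C * M ≤ F) (hl : 0 < lam) (hlσ : 4 * lam * σ ^ 2 ≤ 1)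
    (hlF : lam * (2 * F) ^ 2 ≤ 2) (hε : 0 ≤ ε)
    {c : Fin ns → ℝ} {φ : Fin ns → (Fin d → ℝ) → ℝ}
    {A : Fin ns → Matrix (Fin d) (Fin d) ℝ} {b : Fin ns → Fin d → ℝ}
    (hφm : ∀ i, AEStronglyMeasurable (φ i) (cubeMeasure d))
    (hφ : ∀ i, ∀ᵐ x ∂(cubeMeasure d), |φ i x| ≤ M)
    (hg : ∀ i, ∃ (L S D : ℕ) (g : (Fin d → ℝ) → ℝ), 0 < L ∧ L ≤ m ∧ S ≤ m ∧ D ≤ m ∧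
      g ∈ network d L S D B ∧ eLpNorm (g - φ i) 2 (cubeMeasure d) ≤ ENNReal.ofReal ε)
    (hA : ∀ i, (A i).det ≠ 0) (hAC : ∀ i, |(A i).det|⁻¹ ≤ C) (hAe : ∀ i j k, |A i j k| ≤ C)
    (hb : ∀ i j, |b i j| ≤ C) (hc : ∀ i, |c i| ≤ C)
    {fhat : Sample d n → (Fin d → ℝ) → ℝ}
    (hE : IsERM (clippedNetwork d F L (ns * S) (ns * D) B) fhat) :
    risk σ fhat (fun x => ∑ i, c i * (cube d).indicator (φ i) (A i *ᵥ x - b i))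
      ≤ ENNReal.ofReal (2 * (1 / n) ^ 2 +
      8 * (((ns * S : ℕ) * ((3 * L + 12) * Real.log (B * ((ns * D : ℕ) + 1))) + 1) / (lam * n)
      + (1 / n) * (4 * F + 1 + σ ^ 2)
      + ns ^ 2 * C ^ 3 * (ε ^ 2 + 8 * M ^ 2 * d * (1 / n)))) := by
  choose L₀ S₀ D₀ g hL₀ hL₀m hS₀m hD₀m hg hgφ using hg
  have hnR : (2 : ℝ) ≤ n := by exact_mod_cast hn
  have hB1 : 1 ≤ B := by linarith
  have hF0 : 0 ≤ F := le_trans (by positivity) hF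
  have hδ2 : 2 * (1 / (n : ℝ)) ≤ 1 := by
    rw [mul_one_div, div_le_one (by linarith)]; exact hnR
  have hδ0 : (0 : ℝ) < 1 / n := by positivity
  set f₀ : (Fin d → ℝ) → ℝ :=
    fun x => ∑ i, c i * (cube d).indicator (φ i) (A i *ᵥ x - b i) with hf₀
  -- The strip width is `δ = 1 / n`, so the penalty slope `M / δ = M n` is an admissible weight by
  -- `hMB`.
  set fs : (Fin d → ℝ) → ℝ := fun x => ∑ i, c i *
    (cutoff M (M / (1 / n)) (1 / n) (g i (A i *ᵥ x - b i)) (A i *ᵥ x - b i) true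
      - cutoff M (M / (1 / n)) (1 / n) (g i (A i *ᵥ x - b i)) (A i *ᵥ x - b i) false) with hfs
  have hfsN : fs ∈ network d L (ns * S) (ns * D) B := by
    refine sum_mem_network (zero_le_one.trans hB1) fun i => ?_
    have h1 := hL₀m i
    have h2 := hD₀m i
    have h3 := hS₀m i
    have h4 : 2 * d * L₀ i ≤ 2 * d * m := Nat.mul_le_mul_left _ h1
    have hMn : M ≤ M * n := le_mul_of_one_le_right hM (by linarith)
    refine cutoff_mem_network hB1 hδ0.le (by linarith) ?_ ?_ ((hc i).trans hCB) (hL₀ i) (by omega)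
      (fun j k => (hAe i j k).trans hCB) (fun j => (hb i j).trans hCB) (by omega) (by omega) (hg i)
    · rw [abs_of_nonneg hM]; linarith
    · rw [abs_of_nonneg (by positivity), div_div_eq_mul_div, div_one]; exact hMB
  have hm : AEMeasurable f₀ (cubeMeasure d) := aemeasurable_affine_sum hφm hA
  have hbd : ∀ᵐ x ∂(cubeMeasure d), |f₀ x| ≤ F := by
    filter_upwards [ae_abs_affine_sum_le (b := b) hM hφ hA hc] with x hx
    exact hx.trans hF
  -- A version of the regression function that is measurable and bounded by `F` everywhere.
  set f₁ : (Fin d → ℝ) → ℝ := fun x => max (-F) (min (hm.mk f₀ x) F) with hf₁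
  have hf₁m : Measurable f₁ :=
    measurable_const.max (hm.measurable_mk.min measurable_const)
  have hf₁F : ∀ x, |f₁ x| ≤ F := fun x => abs_clip_le hF0 _
  have heq : f₀ =ᵐ[cubeMeasure d] f₁ := by
    filter_upwards [hm.ae_eq_mk, hbd] with x hx hx'
    rw [hf₁]
    simp only
    rw [← hx, clip_of_abs_le hx']
  rw [risk_congr σ fhat heq]
  refine (risk_le_of_isERM_clippedNetwork (by omega) (by omega) (Nat.mul_pos hns (by omega))
    ((by omega : d ≤ D).trans (Nat.le_mul_of_pos_left D hns)) hB1 hnB hF0 hl hlσ hlF hf₁m hf₁F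
    hfsN hE).trans (ENNReal.ofReal_le_ofReal ?_)
  have hsqm : Measurable fun x => (fs x - f₁ x) ^ 2 :=
    ((continuous_of_mem_network hfsN).measurable.sub hf₁m).pow_const 2
  have hint : ∫ x, (fs x - f₁ x) ^ 2 ∂(cubeMeasure d)
      ≤ ns ^ 2 * C ^ 3 * (ε ^ 2 + 8 * M ^ 2 * d * (1 / n)) := by
    rw [integral_eq_lintegral_of_nonneg_ae (Filter.Eventually.of_forall fun x => sq_nonneg _)
      hsqm.aestronglyMeasurable]
    refine ENNReal.toReal_le_of_le_ofReal (by positivity) ?_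
    refine le_trans (le_of_eq (lintegral_congr_ae ?_)) (lintegral_sum_cutoff_sub_le (b := b) hM hδ0
      hδ2 hε hφm hφ (fun i => (continuous_of_mem_network (hg i)).measurable) hgφ hA hAC hc)
    filter_upwards [heq] with x hx
    rw [← hx]
  gcongr

/-! ### Arithmetic of the rate -/

/-- Sparsity, depth and the logarithm of the parameter range each contribute one factor `log n`;
additive constants are absorbed through `log n ≥ 1 / 2`. -/
theorem entropy_le_log_cube {d n ns L S D : ℕ} {K₁ K₂ B C : ℝ} (hK₁ : 0 ≤ K₁) (hK₂ : 0 ≤ K₂)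
    (hC : 0 ≤ C) (hnB : n ≤ B) (hn : 2 ≤ n) (hℓ : 1 / 2 ≤ Real.log n)
    (hL : (L : ℝ) ≤ K₁ * Real.log n) (hS : (S : ℝ) ≤ K₁ * Real.log n)
    (hD : (D : ℝ) ≤ K₁ * Real.log n) (hB : B ≤ K₂ * n) :
    ((ns * (S + 2 * D * d + d ^ 2 + d + 1) : ℕ) : ℝ) *
        ((3 * (L + 2 : ℕ) + 12) * Real.log (max B C * ((ns * D : ℕ) + 1)))
      ≤ ns * (K₁ + 2 * d * K₁ + 2 * (d ^ 2 + d + 1)) *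
        ((3 * K₁ + 36) * (2 * ((K₂ + C) * (ns * K₁ + 1)) + 2)) * Real.log n ^ 3 := by
  have hnR : (2 : ℝ) ≤ n := by exact_mod_cast hn
  have h1 : ((ns * (S + 2 * D * d + d ^ 2 + d + 1) : ℕ) : ℝ)
      ≤ ns * (K₁ + 2 * d * K₁ + 2 * (d ^ 2 + d + 1)) * Real.log n := by
    push_cast
    rw [mul_assoc (ns : ℝ) (_ + _)]
    refine mul_le_mul_of_nonneg_left ?_ (Nat.cast_nonneg ns)
    have h4 : ((d : ℝ) ^ 2 + d + 1) * (1 / 2) ≤ (d ^ 2 + d + 1) * Real.log n := by gcongr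
    have h5 : (2 * D * d : ℝ) ≤ 2 * (K₁ * Real.log n) * d := by gcongr
    linarith
  have h2 : (3 * (L + 2 : ℕ) + 12 : ℝ) ≤ (3 * K₁ + 36) * Real.log n := by
    push_cast
    linarith
  have hmax1 : 1 ≤ max B C := le_max_of_le_left (by linarith)
  have hE1 : 1 ≤ max B C * ((ns * D : ℕ) + 1 : ℝ) :=
    one_le_mul_of_one_le_of_one_le hmax1 (le_add_of_nonneg_left (Nat.cast_nonneg _))
  have h3 : Real.log (max B C * ((ns * D : ℕ) + 1))
      ≤ (2 * ((K₂ + C) * (ns * K₁ + 1)) + 2) * Real.log n := by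
    have hCn : C ≤ C * n := le_mul_of_one_le_right hC (by linarith)
    have hKn : 0 ≤ K₂ * n := by positivity
    have h4 : max B C ≤ (K₂ + C) * n := by
      rw [add_mul]
      exact max_le (by linarith) (by linarith)
    have h5 : ((ns * D : ℕ) + 1 : ℝ) ≤ (ns * K₁ + 1) * n := by
      have h6 : Real.log n ≤ n := (Real.log_le_sub_one_of_pos (by linarith)).trans (by linarith)
      have h7 : (ns : ℝ) * D ≤ ns * (K₁ * n) := by
        gcongr
        exact hD.trans (by gcongr)
      push_cast
      linarith
    have h8 : max B C * ((ns * D : ℕ) + 1) ≤ (K₂ + C) * (ns * K₁ + 1) * (n : ℝ) ^ 2 := by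
      refine (mul_le_mul h4 h5 (by positivity) (by positivity)).trans (le_of_eq ?_)
      ring
    have ha0 : 0 < (K₂ + C) * (ns * K₁ + 1) :=
      pos_of_mul_pos_left (lt_of_lt_of_le one_pos (hE1.trans h8)) (by positivity)
    generalize (K₂ + C) * (ns * K₁ + 1) = a at h8 ha0 ⊢
    refine (Real.log_le_log (by linarith) h8).trans ?_
    rw [Real.log_mul ha0.ne' (by positivity), Real.log_pow]
    have h9 := Real.log_le_sub_one_of_pos ha0
    have h10 : a * (1 / 2) ≤ a * Real.log n := by gcongr
    push_cast
    linarith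
  have h10 := Real.log_nonneg hE1
  calc _ ≤ ns * (K₁ + 2 * d * K₁ + 2 * (d ^ 2 + d + 1)) * Real.log n * ((3 * K₁ + 36) *
          Real.log n * ((2 * ((K₂ + C) * (ns * K₁ + 1)) + 2) * Real.log n)) := by
        gcongr
    _ = _ := by ring

theorem error_terms_le {n : ℝ} (hn : 0 < n) (u : ℝ) {w : ℝ} (hw : 0 ≤ w) (t : ℝ) :
    1 / n * u + w * ((1 / (n + 1)) ^ 2 + t * (1 / n)) ≤ (u + w * (1 + t)) / n := by
  have hε : (1 / (n + 1)) ^ 2 ≤ 1 / n := by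
    rw [div_pow, one_pow]
    exact one_div_le_one_div_of_le hn (by nlinarith)
  have h1 : w * ((1 / (n + 1)) ^ 2 + t * (1 / n)) ≤ w * (1 / n + t * (1 / n)) := by gcongr
  have e : (u + w * (1 + t)) / n = 1 / n * u + w * (1 / n + t * (1 / n)) := by ring
  rw [e]
  linarith

/-- Elementary form of the final rate computation. -/
theorem rate_le {ℓ n Q lam a κ : ℝ} (hn : 1 ≤ n) (hℓ : 1 / 2 ≤ ℓ) (hl : 0 < lam) (ha : 0 ≤ a)
    (hQ : Q ≤ κ * ℓ ^ 3) :
    2 * (1 / n) ^ 2 + 8 * ((Q + 1) / (lam * n) + a / n)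
      ≤ (8 * κ / lam + 8 * (2 + 8 * (1 / lam + a))) * ℓ ^ 3 / n := by
  have h1 : 1 ≤ 8 * ℓ ^ 3 := by
    have := pow_le_pow_left₀ (by norm_num) hℓ 3
    linarith
  have h2 : (1 / n) ^ 2 ≤ 1 / n := by
    rw [sq]
    exact mul_le_of_le_one_left (by positivity) (by rw [div_le_one (by linarith)]; exact hn)
  have h3 : (Q + 1) / (lam * n) = ((Q + 1) / lam) / n := by rw [div_div]
  have h4 : (Q + 1) / lam ≤ (κ * ℓ ^ 3 + 1) / lam := by gcongr
  have h5 : 2 + 8 * ((κ * ℓ ^ 3 + 1) / lam + a)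
      ≤ (8 * κ / lam + 8 * (2 + 8 * (1 / lam + a))) * ℓ ^ 3 := by
    have h6 : (2 + 8 * (1 / lam + a)) * 1 ≤ (2 + 8 * (1 / lam + a)) * (8 * ℓ ^ 3) := by gcongr
    have h7 : (κ * ℓ ^ 3 + 1) / lam = κ / lam * ℓ ^ 3 + 1 / lam := by ring
    rw [h7]
    have h8 : 8 * κ / lam = 8 * (κ / lam) := by ring
    rw [h8]
    nlinarith
  calc 2 * (1 / n) ^ 2 + 8 * ((Q + 1) / (lam * n) + a / n)
      ≤ 2 * (1 / n) + 8 * (((κ * ℓ ^ 3 + 1) / lam) / n + a / n) := by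
        rw [h3]; gcongr
    _ = (2 + 8 * ((κ * ℓ ^ 3 + 1) / lam + a)) / n := by ring
    _ ≤ _ := by gcongr

end SparseReLU

end

/-! ### Choice of the parameters and conclusion -/

set_option maxHeartbeats 400000 in
theorem theorem5 (d : ℕ) (hd : 1 ≤ d) (Φ : Set ((Fin d → ℝ) → ℝ))
    (hL2 : ∀ φ ∈ Φ, MemLp φ 2 (SparseReLU.cubeMeasure d))
    (hunit : ∀ φ ∈ Φ, eLpNorm φ 2 (SparseReLU.cubeMeasure d) = 1)
    (hbdd : (⨆ φ ∈ Φ, eLpNorm φ ⊤ (SparseReLU.cubeMeasure d)) < ⊤)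
    (C₁ C₂ : ℝ) (hC₁ : 0 < C₁) (hC₂ : 0 < C₂)
    (hAP : Φ ⊆ SparseReLU.AP d C₁ C₂) :
    ∃ (K₁ K₂ : ℝ) (L S D : ℕ → ℕ) (B : ℕ → ℝ),
      (∀ n : ℕ, 2 ≤ n →
        SparseReLU.Admissible d (L n) (S n) (D n) (B n) ∧
        (L n : ℝ) ≤ K₁ * Real.log n ∧ (S n : ℝ) ≤ K₁ * Real.log n ∧
        (D n : ℝ) ≤ K₁ * Real.log n ∧ B n ≤ K₂ * n ∧
        ∀ φ ∈ Φ, ∃ g ∈ SparseReLU.network d (L n) (S n) (D n) (B n),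
          eLpNorm (g - φ) 2 (SparseReLU.cubeMeasure d) ≤ ENNReal.ofReal (1 / n)) ∧
      ∀ (ns : ℕ) (C : ℝ), 0 < ns → 0 < C →
        ∃ F : ℝ, 0 < F ∧ ∀ σ : ℝ, 0 < σ → ∃ C₃ : ℝ, 0 < C₃ ∧
          ∀ n : ℕ, 2 ≤ n →
            ∀ fhat : SparseReLU.Sample d n → (Fin d → ℝ) → ℝ,
              SparseReLU.IsERM
                (SparseReLU.clippedNetwork d F (L n + 2)
                  (ns * (S n + 2 * D n * d + d ^ 2 + d + 1)) (ns * D n) (max (B n) C)) fhat →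
              (⨆ f₀ ∈ SparseReLU.affineClass Φ ns C, SparseReLU.risk σ fhat f₀)
                ≤ ENNReal.ofReal (C₃ * Real.log n ^ 3 / n) := by
  set M : ℝ := (⨆ φ ∈ Φ, eLpNorm φ ⊤ (SparseReLU.cubeMeasure d)).toReal with hM
  have hM0 : 0 ≤ M := ENNReal.toReal_nonneg
  have hΦM : ∀ φ ∈ Φ, ∀ᵐ x ∂(SparseReLU.cubeMeasure d), |φ x| ≤ M := fun φ hφ =>
    SparseReLU.ae_abs_le_of_iSup_eLpNorm hbdd hφ
  -- A common bound for depth, sparsity and width of the approximating networks at accuracy `1 / (n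
  -- + 1)`. The parameters below add the room needed by the cutoff construction.
  set m : ℕ → ℕ := fun n => ⌊C₁ * Real.log (n + 1)⌋₊ with hm
  set L : ℕ → ℕ := fun n => m n + 1 with hLdef
  set D : ℕ → ℕ := fun n => m n + 2 * d + 4 with hDdef
  set S : ℕ → ℕ := fun n => 4 * m n + 2 * d ^ 2 + 14 * d + 2 * d * m n + 2 * (m n + 3) + 14
    with hSdef
  set K₁ : ℝ := (6 + 2 * d) * (2 * C₁) + 2 * (2 * d ^ 2 + 14 * d + 20) with hK₁
  -- The three summands make `K₂ * n` dominate the weights `C₂ (n + 1)` of the approximants, the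
  -- penalty slope `M n`, and `n` itself.
  set K₂ : ℝ := 2 * C₂ + M + 1 with hK₂
  set B : ℕ → ℝ := fun n => K₂ * n with hBdef
  have hK₁0 : 0 ≤ K₁ := by positivity
  have hlog : ∀ n : ℕ, 2 ≤ n → 1 / 2 ≤ Real.log n := fun n hn => by
    have h1 := Real.log_two_gt_d9
    have h2 := Real.log_le_log (by norm_num : (0 : ℝ) < 2) (by exact_mod_cast hn : (2 : ℝ) ≤ n)
    linarith
  have hmle : ∀ n : ℕ, 2 ≤ n → (m n : ℝ) ≤ 2 * C₁ * Real.log n := fun n hn => by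
    have hnR : (2 : ℝ) ≤ n := by exact_mod_cast hn
    have h1 : Real.log (n + 1) ≤ 2 * Real.log n := by
      rw [← Real.log_rpow (by linarith), Real.rpow_two]
      exact Real.log_le_log (by linarith) (by nlinarith)
    have h2 : (m n : ℝ) ≤ C₁ * Real.log (n + 1) :=
      Nat.floor_le (mul_nonneg hC₁.le (Real.log_nonneg (by linarith)))
    nlinarith
  have hSle : ∀ n : ℕ, 2 ≤ n → (S n : ℝ) ≤ K₁ * Real.log n := fun n hn => by
    have h1 := hmle n hn
    have h2 := hlog n hn
    have h3 : (S n : ℝ) = (6 + 2 * d) * m n + (2 * d ^ 2 + 14 * d + 20) := by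
      simp only [hSdef]; push_cast; ring
    have h4 : (6 + 2 * (d : ℝ)) * m n ≤ (6 + 2 * d) * (2 * C₁ * Real.log n) := by gcongr
    have h5 : (2 * (d : ℝ) ^ 2 + 14 * d + 20) * (1 / 2)
        ≤ (2 * (d : ℝ) ^ 2 + 14 * d + 20) * Real.log n := by gcongr
    rw [h3, hK₁]
    linarith
  have hLle : ∀ n : ℕ, 2 ≤ n → (L n : ℝ) ≤ K₁ * Real.log n := fun n hn =>
    le_trans (by exact_mod_cast (by simp only [hLdef, hSdef]; omega : L n ≤ S n)) (hSle n hn)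
  have hDle : ∀ n : ℕ, 2 ≤ n → (D n : ℝ) ≤ K₁ * Real.log n := fun n hn =>
    le_trans (by exact_mod_cast (by simp only [hDdef, hSdef]; omega : D n ≤ S n)) (hSle n hn)
  have hnB : ∀ n : ℕ, (n : ℝ) ≤ B n := fun n =>
    le_mul_of_one_le_left (Nat.cast_nonneg n) (by linarith)
  have hC₂B : ∀ n : ℕ, 2 ≤ n → C₂ * (n + 1) ≤ B n := fun n hn => by
    have hnR : (2 : ℝ) ≤ n := by exact_mod_cast hn
    simp only [hBdef, hK₂]
    nlinarith [mul_nonneg hM0 (Nat.cast_nonneg (α := ℝ) n)]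
  refine ⟨K₁, K₂, L, S, D, B, fun n hn => ?_, fun ns C hns hC => ?_⟩
  · have hnR : (2 : ℝ) ≤ n := by exact_mod_cast hn
    refine ⟨⟨by simp only [hLdef]; omega, by simp only [hSdef]; omega,
      by simp only [hDdef]; omega, by simp only [hDdef]; omega, by linarith [hnB n]⟩,
      hLle n hn, hSle n hn, hDle n hn, le_rfl, fun φ hφ => ?_⟩
    obtain ⟨L₀, S₀, D₀, g, h0, h1, h2, h3, h4, h5⟩ :=
      SparseReLU.exists_network_of_AP (hAP hφ) hn (hC₂B n hn)
    -- The depth of the approximant varies with `φ`, so it is padded to the common depth `m n + 1`.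
    refine ⟨g, SparseReLU.network_subset_of_depth_lt (by linarith [hnB n]) h0 ?_ ?_ ?_ ?_ h4,
      h5.trans (ENNReal.ofReal_le_ofReal (one_div_le_one_div_of_le (by linarith) (by linarith)))⟩
    · simp only [hLdef, hm]; omega
    · simp only [hDdef, hm]; omega
    · simp only [hDdef]; omega
    · simp only [hLdef, hSdef, hm]; omega
  · set F : ℝ := ns * C * M + 1 with hF
    have hF0 : 0 < F := by positivity
    refine ⟨F, hF0, fun σ hσ => ?_⟩
    -- Small enough for both exponential moment conditions, where differences of functions are
    -- bounded by `2 F`; it does not depend on `n`.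
    set lam : ℝ := 1 / (4 * σ ^ 2 + 2 * F ^ 2 + 1) with hlam
    have hlam0 : 0 < lam := by positivity
    have hlσ : 4 * lam * σ ^ 2 ≤ 1 := by
      rw [hlam, mul_one_div, div_mul_eq_mul_div, div_le_one (by positivity)]
      nlinarith [sq_nonneg F]
    have hlF : lam * (2 * F) ^ 2 ≤ 2 := by
      rw [hlam, one_div_mul_eq_div, div_le_iff₀ (by positivity)]
      nlinarith [sq_nonneg σ]
    have hK₂0 : 0 ≤ K₂ := by positivity
    set κ : ℝ := ns * (K₁ + 2 * d * K₁ + 2 * (d ^ 2 + d + 1)) *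
      ((3 * K₁ + 36) * (2 * ((K₂ + C) * (ns * K₁ + 1)) + 2)) with hκ
    set A₀ : ℝ := 4 * F + 1 + σ ^ 2 + ns ^ 2 * C ^ 3 * (1 + 8 * M ^ 2 * d) with hA₀
    refine ⟨8 * κ / lam + 8 * (2 + 8 * (1 / lam + A₀)), by positivity,
      fun n hn fhat hE => iSup₂_le fun f₀ hf₀ => ?_⟩
    obtain ⟨c, φ, A, b, h, rfl⟩ := hf₀
    have hnR : (2 : ℝ) ≤ n := by exact_mod_cast hn
    have hℓ := hlog n hn
    have hMB : M * n ≤ B n := by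
      simp only [hBdef]
      exact mul_le_mul_of_nonneg_right (by linarith) (Nat.cast_nonneg n)
    -- The class has depth `L n + 2 = m n + 3`: one layer for the affine map and two for the cutoff
    -- on top of depth at most `m n`. The width `D n` and the nonzero count `S n` suffice on their
    -- own.
    have hrisk := SparseReLU.risk_le_of_affine_sum (m := m n) (ε := 1 / (n + 1)) hn hns
      (by simp only [hLdef]; omega) (by simp only [hDdef]; omega)
      (by simp only [hLdef, hSdef]; omega) ((hnB n).trans (le_max_left _ C))
      (hMB.trans (le_max_left _ C)) (le_max_right _ _) hM0 hC.le (by linarith : ns * C * M ≤ F)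
      hlam0 hlσ hlF (by positivity) (fun i => (hL2 _ (h i).1).1) (fun i => hΦM _ (h i).1)
      (fun i => SparseReLU.exists_network_of_AP (hAP (h i).1) hn
        ((hC₂B n hn).trans (le_max_left _ C)))
      (fun i => (h i).2.1) (fun i => (h i).2.2.1) (fun i => (h i).2.2.2.1)
      (fun i => (h i).2.2.2.2.1) (fun i => (h i).2.2.2.2.2) hE
    refine hrisk.trans (ENNReal.ofReal_le_ofReal ?_)
    have hQ := SparseReLU.entropy_le_log_cube (d := d) (ns := ns) hK₁0 hK₂0 hC.le (hnB n) hn hℓ (hLle n hn)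
      (hSle n hn) (hDle n hn) le_rfl
    refine le_trans ?_ (SparseReLU.rate_le (by linarith : (1 : ℝ) ≤ n) hℓ hlam0
      (by positivity : 0 ≤ A₀) hQ)
    have hsum := SparseReLU.error_terms_le (by linarith : (0 : ℝ) < n) (4 * F + 1 + σ ^ 2)
      (by positivity : 0 ≤ (ns : ℝ) ^ 2 * C ^ 3) (8 * M ^ 2 * d)
    linarith
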